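/- Let $s,t\ge 1$ be coprime integers. Identify the space $T_A$ of trinomials $f=z^{s+t}+pz^t+q$ with $p,q\in\mathbb{C}^*$ with $(\mathbb{C}^*)^2$ (coordinates $(p,q)$). Let $U_t^A\subset T_A$ be the set of those $f$ for which, when the $s+t$ complex roots (counted with multiplicity) are ordered by increasing absolute value, the $t$-th and the $(t+1)$-st root have different absolute values; let $(U_t^A)^c=T_A\setminus U_t^A$, and let $\mathcal{V}(D)\subset T_A$ be the set of trinomials whose discriminant vanishes. Here "$Y$ is a deformation retract of $X$" means that there is a homotopy of maps $X\to X$ from the identity to a map with image in $Y$ that fixes every point of $Y$ at all times. The torus knot $K(s+t,s)\subset T_A$ is the closed curve $\{(e^{is\varphi},e^{i(s+t)\varphi}) : \varphi\in\mathbb{R}\}$ on the standard torus $|p|=|q|=1$. Then: 1. $\mathcal{V}(D)$ is a deformation retract of $(U_t^A)^c$. 2. $\mathcal{V}(D)$ has a deformation retract $K$ which is a torus knot $K(s+t,s)$: there is an ambient isotopy of $T_A$ that carries $K$ to the curve $K(s+t,s)$ and at each time maps $K$ into some torus $\{|p|=a,\ |q|=b\}$. Moreover, $\mathcal{V}(D)$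 is connected but not simply connected, and $\pi_1(\mathcal{V}(D))\cong\mathbb{Z}$. 3. $U_t^A$ is connected and $\pi_1(U_t^A)\cong\mathbb{Z}^2$. -/

import Mathlib

noncomputable section

/-- The space of trinomials `z ^ (s + t) + p z ^ t + q` with nonzero coefficients, identified with
the space `(ℂ^*)²` of coefficient pairs `(p, q)`. -/
abbrev TrinomialSpace : Type := ℂˣ × ℂˣ

/-- The trinomial `z ^ (s + t) + p z ^ t + q` with coefficient pair `x = (p, q)`. -/
def trinomial (s t : ℕ) (x : TrinomialSpace) : Polynomial ℂ :=
  Polynomial.X ^ (s + t) + Polynomial.C (x.1 : ℂ) * Polynomial.X ^ t + Polynomial.C (x.2 : ℂ)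

/-- The norms of the roots (with multiplicity) of the trinomial, in increasing order. -/
def sortedRootNorms (s t : ℕ) (x : TrinomialSpace) : List ℝ :=
  ((trinomial s t x).roots.map fun z => ‖z‖).sort

/-- The norm of the `j`-th smallest root, for `1 ≤ j ≤ s + t` (so counting starts at one). -/
def rootNorm (s t : ℕ) (x : TrinomialSpace) (j : ℕ) : ℝ :=
  (sortedRootNorms s t x).getD (j - 1) 0

/-- The set of trinomials whose `j`-th and `(j + 1)`-th smallest roots have distinct norms;
by convention it is the whole space for `j = 0` and for `j = s + t`. -/
def distinctNormSet (s t j : ℕ) : Set TrinomialSpace :=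
  {x | j = 0 ∨ j = s + t ∨ rootNorm s t x j ≠ rootNorm s t x (j + 1)}

/-- The zero set of the discriminant in the space of trinomials. -/
def discriminantLocus (s t : ℕ) : Set TrinomialSpace :=
  {x | (trinomial s t x).discr = 0}

/-- `A` is a deformation retract of `X`: there is a homotopy of maps from `X` to itself which
starts at the identity, fixes `A` pointwise at all times, and ends with a map into `A`. -/
def IsDeformationRetract {Y : Type*} [TopologicalSpace Y] (A X : Set Y) : Prop :=
  A ⊆ X ∧ ∃ F : unitInterval × X → X, Continuous F ∧
    (∀ x, F (0, x) = x) ∧ (∀ x, (F (1, x) : Y) ∈ A) ∧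
    ∀ (u : unitInterval) (x : X), (x : Y) ∈ A → F (u, x) = x

/-- The torus of all `(p, q)` with `|p| = a` and `|q| = b`. -/
def coordinateTorus (a b : ℝ) : Set TrinomialSpace :=
  {x | ‖(x.1 : ℂ)‖ = a ∧ ‖(x.2 : ℂ)‖ = b}

/-- The torus knot `K(m, n)` on the standard torus `|p| = |q| = 1`: the closed curve
`φ ↦ (e ^ (i n φ), e ^ (i m φ))`. -/
def standardTorusKnot (m n : ℕ) : Set TrinomialSpace :=
  Set.range fun z : Circle => (Circle.toUnits (z ^ n), Circle.toUnits (z ^ m))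

/-- `K` is a torus knot `K(m, n)`: an ambient isotopy of the space of trinomials carries `K` to the
standard torus knot, and at each time the image of `K` lies on a torus `|p| = a`, `|q| = b`. -/
def IsTorusKnot (m n : ℕ) (K : Set TrinomialSpace) : Prop :=
  ∃ H : unitInterval → (TrinomialSpace ≃ₜ TrinomialSpace),
    Continuous (fun z : unitInterval × TrinomialSpace => H z.1 z.2) ∧
    H 0 = Homeomorph.refl TrinomialSpace ∧
    H 1 '' K = standardTorusKnot m n ∧
    ∀ u, ∃ a b : ℝ, H u '' K ⊆ coordinateTorus a b

end

noncomputable section Topology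

/-- The fundamental group of a product is the product of the fundamental groups. -/
theorem fundamentalGroup_prod {X Y : Type*} [TopologicalSpace X] [TopologicalSpace Y]
    (x : X) (y : Y) :
    Nonempty (FundamentalGroup (X × Y) (x, y) ≃* FundamentalGroup X x × FundamentalGroup Y y) := by
  let f : FundamentalGroup (X × Y) (x, y) →* FundamentalGroup X x × FundamentalGroup Y y :=
    (FundamentalGroup.map ContinuousMap.fst (x, y)).prod
      (FundamentalGroup.map ContinuousMap.snd (x, y))
  have hf (γ : FundamentalGroup (X × Y) (x, y)) :
      f γ = (Path.Homotopic.projLeft γ, Path.Homotopic.projRight γ) := rfl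
  refine ⟨MulEquiv.ofBijective f ⟨fun γ δ h => ?_, fun ⟨γ, δ⟩ => ?_⟩⟩
  · rw [hf, hf, Prod.mk.injEq] at h
    rw [← Path.Homotopic.prod_projLeft_projRight γ, ← Path.Homotopic.prod_projLeft_projRight δ,
      h.1, h.2]
  · refine ⟨Path.Homotopic.prod γ δ, ?_⟩
    rw [hf, Path.Homotopic.projLeft_prod, Path.Homotopic.projRight_prod]

/-- A homotopy equivalence induces isomorphisms of fundamental groups. -/
theorem ContinuousMap.HomotopyEquiv.fundamentalGroup {X Y : Type} [TopologicalSpace X]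
    [TopologicalSpace Y] (e : ContinuousMap.HomotopyEquiv X Y) (x : X) :
    ∃ y : Y, Nonempty (FundamentalGroup X x ≃* FundamentalGroup Y y) :=
  let E := FundamentalGroupoidFunctor.equivOfHomotopyEquiv e
  ⟨(E.functor.obj (FundamentalGroupoid.mk x)).as,
    ⟨E.fullyFaithfulFunctor.mulEquivEnd (FundamentalGroupoid.mk x)⟩⟩

/-- A space homotopy equivalent to a path connected space is path connected. -/
theorem ContinuousMap.HomotopyEquiv.pathConnectedSpace {X Y : Type*} [TopologicalSpace X]
    [TopologicalSpace Y] [PathConnectedSpace Y] (e : ContinuousMap.HomotopyEquiv X Y) :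
    PathConnectedSpace X := by
  obtain ⟨H⟩ := e.left_inv
  have hx (x : X) : Joined (e.invFun (e.toFun x)) x := ⟨H.evalAt x⟩
  refine ⟨⟨e.invFun Classical.ofNonempty⟩, fun x y => (hx x).symm.trans (Joined.trans ?_ (hx y))⟩
  exact ⟨(PathConnectedSpace.somePath (e.toFun x) (e.toFun y)).map e.invFun.continuous⟩

/-- The fundamental group of the punctured complex plane. -/
theorem fundamentalGroup_complex_ne_zero (x : {z : ℂ // z ≠ 0}) :
    Nonempty (FundamentalGroup {z : ℂ // z ≠ 0} x ≃* Multiplicative ℤ) := by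
  have h := Complex.isAddQuotientCoveringMap_exp
  have e : (Multiplicative (AddSubgroup.zmultiples (2 * Real.pi * Complex.I : ℂ)))ᵐᵒᵖ ≃*
      Multiplicative ℤ :=
    (MulOpposite.opMulEquiv.symm).trans (AddEquiv.toMultiplicative
      (AddEquiv.ofBijective (zmultiplesHom _ ⟨_, AddSubgroup.mem_zmultiples _⟩)
        ⟨fun a b hab => by simpa [Real.pi_ne_zero] using congrArg Subtype.val hab,
          fun ⟨b, k, hk⟩ => ⟨k, Subtype.ext (by simpa using hk)⟩⟩).symm)
  exact ⟨(h.fundamentalGroupEquiv ⟨Complex.log x, Subtype.ext (Complex.exp_log x.2)⟩).trans e⟩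

/-- The units of `ℂ` are the punctured plane. -/
noncomputable def complexUnitsHomeomorph : ℂˣ ≃ₜ {z : ℂ // z ≠ 0} where
  toEquiv := unitsEquivNeZero
  continuous_toFun := Units.continuous_val.subtype_mk _
  continuous_invFun := Units.isEmbedding_val₀.continuous_iff.2 continuous_subtype_val

theorem fundamentalGroup_complexUnits (x : ℂˣ) :
    Nonempty (FundamentalGroup ℂˣ x ≃* Multiplicative ℤ) := by
  obtain ⟨y, ⟨e⟩⟩ := complexUnitsHomeomorph.toHomotopyEquiv.fundamentalGroup x
  obtain ⟨f⟩ := fundamentalGroup_complex_ne_zero y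
  exact ⟨e.trans f⟩

/-- The exponential, as a map to the units. -/
noncomputable def expUnit (z : ℂ) : ℂˣ := Units.mk0 (Complex.exp z) (Complex.exp_ne_zero z)

theorem continuous_expUnit : Continuous expUnit :=
  Units.isEmbedding_val₀.continuous_iff.2 Complex.continuous_exp

theorem expUnit_log (x : ℂˣ) : expUnit (Complex.log x) = x :=
  Units.ext (Complex.exp_log x.ne_zero)

theorem expUnit_zero : expUnit 0 = 1 := Units.ext Complex.exp_zero

instance : PathConnectedSpace ℂˣ :=
  Function.Surjective.pathConnectedSpace (f := expUnit) (fun x => ⟨_, expUnit_log x⟩)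
    continuous_expUnit

/-- The radial homotopy of `ℂˣ` onto the circle of radius `exp a`. -/
noncomputable def radial (a u : ℝ) (w : ℂˣ) : ℂˣ :=
  w * expUnit ((u * (a - Real.log ‖(w : ℂ)‖) : ℝ) : ℂ)

theorem continuous_radial (a : ℝ) : Continuous fun x : ℝ × ℂˣ => radial a x.1 x.2 := by
  unfold radial
  refine continuous_snd.mul (continuous_expUnit.comp (Complex.continuous_ofReal.comp ?_))
  refine continuous_fst.mul (continuous_const.sub (Continuous.log ?_ fun x => by simp))
  exact (Units.continuous_val.comp continuous_snd).norm

theorem radial_zero (a : ℝ) (w : ℂˣ) : radial a 0 w = w := by simp [radial, expUnit_zero]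

theorem coe_radial (a u : ℝ) (w : ℂˣ) : (radial a u w : ℂ) =
    w * (Real.exp (u * (a - Real.log ‖(w : ℂ)‖)) : ℝ) := by
  simp [radial, expUnit]

theorem norm_radial_one (a : ℝ) (w : ℂˣ) : ‖(radial a 1 w : ℂ)‖ = Real.exp a := by
  rw [coe_radial, norm_mul, Complex.norm_real, Real.norm_of_nonneg (Real.exp_pos _).le, one_mul,
    Real.exp_sub, Real.exp_log (by simp)]
  field_simp [show ‖(w : ℂ)‖ ≠ 0 by simp]

theorem radial_eq_self {a : ℝ} {w : ℂˣ} (h : ‖(w : ℂ)‖ = Real.exp a) (u : ℝ) :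
    radial a u w = w := by
  simp [radial, h, expUnit_zero]

/-- A set of units preserved by the radial homotopy onto a circle it contains is homotopy
equivalent to `ℂˣ`. -/
noncomputable def radialHomotopyEquiv (a : ℝ) (S : Set ℂˣ)
    (h1 : ∀ w : ℂˣ, ‖(w : ℂ)‖ = Real.exp a → w ∈ S)
    (h2 : ∀ w ∈ S, ∀ u ∈ Set.Icc (0 : ℝ) 1, radial a u w ∈ S) :
    ContinuousMap.HomotopyEquiv S ℂˣ where
  toFun := ⟨Subtype.val, continuous_subtype_val⟩
  invFun := ⟨fun w => ⟨radial a 1 w, h1 _ (norm_radial_one a w)⟩,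
    ((continuous_radial a).comp (continuous_const.prodMk continuous_id)).subtype_mk _⟩
  left_inv := ⟨ContinuousMap.Homotopy.symm
    { toFun := fun x => ⟨radial a x.1 x.2, h2 _ x.2.2 _ x.1.2⟩
      continuous_toFun := ((continuous_radial a).comp
        ((continuous_subtype_val.comp continuous_fst).prodMk
          (continuous_subtype_val.comp continuous_snd))).subtype_mk _
      map_zero_left := fun w => Subtype.ext (radial_zero a w)
      map_one_left := fun _ => rfl }⟩
  right_inv := ⟨ContinuousMap.Homotopy.symm
    { toFun := fun x => radial a x.1 x.2
      continuous_toFun := (continuous_radial a).comp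
        ((continuous_subtype_val.comp continuous_fst).prodMk continuous_snd)
      map_zero_left := radial_zero a
      map_one_left := fun _ => rfl }⟩

/-- A global homotopy which preserves `X` and fixes `A` gives a deformation retract. -/
theorem IsDeformationRetract.of_homotopy {Y : Type*} [TopologicalSpace Y] {A X : Set Y}
    (hAX : A ⊆ X) (G : ℝ → Y → Y) (hG : Continuous fun x : ℝ × Y => G x.1 x.2)
    (h0 : ∀ y ∈ X, G 0 y = y) (h1 : ∀ y ∈ X, G 1 y ∈ A)
    (hX : ∀ u ∈ Set.Icc (0 : ℝ) 1, ∀ y ∈ X, G u y ∈ X)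
    (hA : ∀ u ∈ Set.Icc (0 : ℝ) 1, ∀ y ∈ A, G u y = y) : IsDeformationRetract A X :=
  ⟨hAX, fun x => ⟨G x.1 x.2, hX _ x.1.2 _ x.2.2⟩,
    (hG.comp ((continuous_subtype_val.comp continuous_fst).prodMk
          (continuous_subtype_val.comp continuous_snd))).subtype_mk _,
    fun x => Subtype.ext (h0 _ x.2), fun ⟨_, hx⟩ => h1 _ hx,
    fun u _ hx => Subtype.ext (hA _ u.2 _ hx)⟩

/-- Deformation retracts are invariant under homeomorphisms. -/
theorem IsDeformationRetract.preimage {Y Z : Type*} [TopologicalSpace Y] [TopologicalSpace Z]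
    (e : Y ≃ₜ Z) {A X : Set Z} (h : IsDeformationRetract A X) :
    IsDeformationRetract (e ⁻¹' A) (e ⁻¹' X) := by
  obtain ⟨hAX, F, hF, h0, h1, hA⟩ := h
  refine ⟨Set.preimage_mono hAX, fun x => ⟨e.symm (F (x.1, ⟨e x.2, x.2.2⟩)), ?_⟩, ?_, ?_, ?_, ?_⟩
  · simp
  · refine Continuous.subtype_mk (e.symm.continuous.comp (continuous_subtype_val.comp
      (hF.comp (continuous_fst.prodMk (Continuous.subtype_mk ?_ _))))) _
    exact e.continuous.comp (continuous_subtype_val.comp continuous_snd)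
  · intro x
    simp [h0]
  · intro x
    simpa using h1 _
  · intro u x hx
    have := hA u ⟨e x, x.2⟩ hx
    simp [this]

/-- The monomial change of coordinates `(p, q) ↦ (p ^ n / q ^ s, p ^ a q ^ b)` of the torus, where
`a s + b n = 1`. -/
def monomialCoordinates (s n a b : ℤ) (h : a * s + b * n = 1) :
    TrinomialSpace ≃ₜ ℂˣ × ℂˣ where
  toFun x := (x.1 ^ n * x.2 ^ (-s), x.1 ^ a * x.2 ^ b)
  invFun y := (y.1 ^ b * y.2 ^ s, y.1 ^ (-a) * y.2 ^ n)
  left_inv x := by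
    simp only [mul_zpow, ← zpow_mul]
    refine Prod.ext ?_ ?_
    · calc _ = x.1 ^ (n * b + a * s) * x.2 ^ (-s * b + b * s) := by
            rw [zpow_add, zpow_add]; ac_rfl
        _ = x.1 := by
          rw [show n * b + a * s = 1 by linarith, show -s * b + b * s = 0 by ring]; simp
    · calc _ = x.1 ^ (n * -a + a * n) * x.2 ^ (-s * -a + b * n) := by
            rw [zpow_add, zpow_add]; ac_rfl
        _ = x.2 := by
          rw [show -s * -a + b * n = 1 by linarith, show n * -a + a * n = 0 by ring]; simp
  right_inv y := by
    simp only [mul_zpow, ← zpow_mul]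
    refine Prod.ext ?_ ?_
    · calc _ = y.1 ^ (b * n + -a * -s) * y.2 ^ (s * n + n * -s) := by
            rw [zpow_add, zpow_add]; ac_rfl
        _ = y.1 := by
          rw [show b * n + -a * -s = 1 by linarith, show s * n + n * -s = 0 by ring]; simp
    · calc _ = y.1 ^ (b * a + -a * b) * y.2 ^ (s * a + n * b) := by
            rw [zpow_add, zpow_add]; ac_rfl
        _ = y.2 := by
          rw [show s * a + n * b = 1 by linarith, show b * a + -a * b = 0 by ring]; simp
  continuous_toFun := ((continuous_fst.zpow _).mul (continuous_snd.zpow _)).prodMk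
    ((continuous_fst.zpow _).mul (continuous_snd.zpow _))
  continuous_invFun := ((continuous_fst.zpow _).mul (continuous_snd.zpow _)).prodMk
    ((continuous_fst.zpow _).mul (continuous_snd.zpow _))

/-- The half-open segment from `0` (excluded) to `w₀` (included). -/
def unitSegment (w₀ : ℂˣ) : Set ℂˣ := {w | ∃ τ : ℝ, 0 < τ ∧ τ ≤ 1 ∧ (w : ℂ) = τ * w₀}

theorem radial_eq_real_mul {a u τ : ℝ} {w w₀ : ℂˣ} (hτ : 0 < τ) (h : (w : ℂ) = τ * w₀) :
    (radial a u w : ℂ) =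
      (Real.exp ((1 - u) * Real.log τ + u * (a - Real.log ‖(w₀ : ℂ)‖)) : ℝ) * w₀ := by
  have h2 : Real.log ‖(w : ℂ)‖ = Real.log τ + Real.log ‖(w₀ : ℂ)‖ := by
    rw [h, norm_mul, Complex.norm_real, Real.norm_of_nonneg hτ.le, Real.log_mul hτ.ne' (by simp)]
  rw [coe_radial, h2, h]
  nth_rw 1 [← Real.exp_log hτ]
  rw [mul_right_comm, ← Complex.ofReal_mul, ← Real.exp_add]
  congr 3
  ring

theorem exists_eq_real_mul_of_radial {a u τ : ℝ} {w w₀ : ℂˣ} (hτ : 0 < τ)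
    (h : (radial a u w : ℂ) = τ * w₀) : ∃ σ : ℝ, 0 < σ ∧ (w : ℂ) = σ * w₀ ∧
      Real.log τ = (1 - u) * Real.log σ + u * (a - Real.log ‖(w₀ : ℂ)‖) := by
  set E := Real.exp (u * (a - Real.log ‖(w : ℂ)‖)) with hE
  have hEpos : 0 < E := Real.exp_pos _
  have hw : (w : ℂ) = (τ / E : ℝ) * w₀ := by
    rw [coe_radial, ← hE] at h
    have : (E : ℂ) ≠ 0 := by exact_mod_cast hEpos.ne'
    push_cast
    field_simp
    linear_combination h
  have hσ : 0 < τ / E := by positivity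
  refine ⟨τ / E, hσ, hw, ?_⟩
  have h3 := radial_eq_real_mul (a := a) (u := u) hσ hw
  rw [h] at h3
  have h4 := mul_right_cancel₀ w₀.ne_zero h3
  rw [Complex.ofReal_inj] at h4
  nth_rw 1 [h4]
  rw [Real.log_exp]

theorem isDeformationRetract_unitSegment (w₀ : ℂˣ) :
    IsDeformationRetract ({w₀} ×ˢ Set.univ : Set (ℂˣ × ℂˣ)) (unitSegment w₀ ×ˢ Set.univ) := by
  have hw₀ : ‖(w₀ : ℂ)‖ = Real.exp (Real.log ‖(w₀ : ℂ)‖) := (Real.exp_log (by simp)).symm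
  refine IsDeformationRetract.of_homotopy ?_
    (fun u y => (radial (Real.log ‖(w₀ : ℂ)‖) u y.1, y.2)) ?_ ?_ ?_ ?_ ?_
  · rintro ⟨w, v⟩ ⟨rfl, -⟩
    exact ⟨⟨1, one_pos, le_rfl, by simp⟩, trivial⟩
  · exact ((continuous_radial _).comp (continuous_fst.prodMk continuous_snd.fst)).prodMk
      continuous_snd.snd
  · rintro ⟨w, v⟩ -
    simp [radial_zero]
  · rintro ⟨w, v⟩ ⟨⟨τ, hτ, -, h⟩, -⟩
    refine ⟨Units.ext ?_, trivial⟩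
    simp [radial_eq_real_mul hτ h]
  · rintro u ⟨hu0, hu1⟩ ⟨w, v⟩ ⟨⟨τ, hτ, hτ1, h⟩, -⟩
    refine ⟨⟨_, Real.exp_pos _, ?_, radial_eq_real_mul hτ h⟩, trivial⟩
    rw [Real.exp_le_one_iff]
    have := mul_nonneg (sub_nonneg.2 hu1) (neg_nonneg.2 (Real.log_nonpos hτ.le hτ1))
    linarith
  · rintro u - ⟨w, v⟩ ⟨rfl, -⟩
    exact Prod.ext (radial_eq_self hw₀ u) rfl

theorem isDeformationRetract_unitCircle (w₀ : ℂˣ) :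
    IsDeformationRetract ({w₀} ×ˢ {v : ℂˣ | ‖(v : ℂ)‖ = 1} : Set (ℂˣ × ℂˣ))
      ({w₀} ×ˢ Set.univ) := by
  refine IsDeformationRetract.of_homotopy (Set.prod_mono le_rfl (Set.subset_univ _))
    (fun u y => (y.1, radial 0 u y.2)) ?_ ?_ ?_ ?_ ?_
  · exact continuous_snd.fst.prodMk
      ((continuous_radial _).comp (continuous_fst.prodMk continuous_snd.snd))
  · rintro ⟨w, v⟩ -
    simp [radial_zero]
  · rintro ⟨w, v⟩ ⟨h, -⟩
    exact ⟨h, by simp [norm_radial_one]⟩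
  · rintro u - ⟨w, v⟩ ⟨h, -⟩
    exact ⟨h, trivial⟩
  · rintro u - ⟨w, v⟩ ⟨-, h⟩
    exact Prod.ext rfl (radial_eq_self (by simpa using h) u)

/-- The complement of a segment starting at the puncture is homotopy equivalent to `ℂˣ`. -/
def unitSegmentComplEquiv (w₀ : ℂˣ) :
    ContinuousMap.HomotopyEquiv ↥(unitSegment w₀)ᶜ ℂˣ := by
  refine radialHomotopyEquiv (Real.log ‖(w₀ : ℂ)‖ + 1) _ ?_ ?_
  · rintro w hw ⟨τ, hτ, hτ1, h⟩
    rw [h, norm_mul, Complex.norm_real, Real.norm_of_nonneg hτ.le, Real.exp_add,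
      Real.exp_log (by simp), mul_comm] at hw
    have := mul_left_cancel₀ (by simp) hw
    have := Real.add_one_lt_exp one_ne_zero
    linarith
  · rintro w hw u ⟨hu0, hu1⟩ ⟨τ, hτ, hτ1, h⟩
    obtain ⟨σ, hσ, hwσ, hlog⟩ := exists_eq_real_mul_of_radial hτ h
    refine hw ⟨σ, hσ, ?_, hwσ⟩
    by_contra! hσ1
    have h1 := Real.log_pos hσ1
    have h2 := Real.log_nonpos hτ.le hτ1
    have h3 := mul_nonneg (sub_nonneg.2 hu1) h1.le
    rcases hu0.eq_or_lt with rfl | hu0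
    · linarith
    · have : Real.log ‖(w₀ : ℂ)‖ + 1 - Real.log ‖(w₀ : ℂ)‖ = 1 := by ring
      rw [this] at hlog
      linarith

/-- The preimage of a product set under a homeomorphism onto a product. -/
def homeomorphPreimageProd {X Y Z : Type*} [TopologicalSpace X] [TopologicalSpace Y]
    [TopologicalSpace Z] (e : X ≃ₜ Y × Z) (S : Set Y) : ↥(e ⁻¹' (S ×ˢ Set.univ)) ≃ₜ S × Z where
  toFun x := (⟨(e x).1, x.2.1⟩, (e x).2)
  invFun y := ⟨e.symm (y.1, y.2), by simp⟩
  left_inv x := by simp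
  right_inv y := by simp
  continuous_toFun := (Continuous.subtype_mk
    (continuous_fst.comp (e.continuous.comp continuous_subtype_val)) _).prodMk
    (continuous_snd.comp (e.continuous.comp continuous_subtype_val))
  continuous_invFun := Continuous.subtype_mk (e.symm.continuous.comp
    ((continuous_subtype_val.comp continuous_fst).prodMk continuous_snd)) _

/-- A singleton times a space is homeomorphic to the space. -/
def homeomorphPreimageSingletonProd {X Y Z : Type*} [TopologicalSpace X] [TopologicalSpace Y]
    [TopologicalSpace Z] (e : X ≃ₜ Y × Z) (w : Y) : ↥(e ⁻¹' ({w} ×ˢ Set.univ)) ≃ₜ Z :=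
  (homeomorphPreimageProd e {w}).trans (Homeomorph.uniqueProd ({w} : Set Y) Z)

theorem circle_toUnits_range (v : ℂˣ) (hv : ‖(v : ℂ)‖ = 1) : ∃ z : Circle, Circle.toUnits z = v :=
  ⟨⟨v, by simpa [Submonoid.unitSphere] using hv⟩, Units.ext rfl⟩

theorem isTorusKnot_preimage (s n : ℕ) (a b : ℤ) (h : a * (s : ℤ) + b * (n : ℤ) = 1) (w₀ : ℂˣ) :
    IsTorusKnot n s (monomialCoordinates s n a b h ⁻¹'
      ({w₀} ×ˢ {v : ℂˣ | ‖(v : ℂ)‖ = 1})) := by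
  set K := monomialCoordinates s n a b h ⁻¹' ({w₀} ×ˢ {v : ℂˣ | ‖(v : ℂ)‖ = 1}) with hK
  have hKrange : K = Set.range fun z : Circle =>
      ((w₀ ^ b * Circle.toUnits (z ^ s), w₀ ^ (-a) * Circle.toUnits (z ^ n)) : TrinomialSpace) := by
    rw [hK, ← Homeomorph.image_symm]
    ext x
    constructor
    · rintro ⟨⟨w, v⟩, ⟨hw, hv⟩, rfl⟩
      obtain ⟨z, rfl⟩ := circle_toUnits_range v hv
      refine ⟨z, ?_⟩
      obtain rfl : w = w₀ := hw
      simp only [map_pow]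
      simp [monomialCoordinates]
    · rintro ⟨z, rfl⟩
      refine ⟨(w₀, Circle.toUnits z), ⟨rfl, Circle.norm_coe z⟩, ?_⟩
      simp only [map_pow]
      simp [monomialCoordinates]
  let α := Complex.log (w₀ ^ b : ℂˣ)
  let β := Complex.log (w₀ ^ (-a) : ℂˣ)
  let γ : ℝ → TrinomialSpace := fun u => (expUnit (-(u * α)), expUnit (-(u * β)))
  have hγ : Continuous γ :=
    (continuous_expUnit.comp (by fun_prop)).prodMk (continuous_expUnit.comp (by fun_prop))
  refine ⟨fun u => Homeomorph.mulLeft (γ u), ?_, ?_, ?_, ?_⟩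
  · exact (hγ.comp (continuous_subtype_val.comp continuous_fst)).mul continuous_snd
  · ext x <;> simp [γ, expUnit_zero]
  · have e1 : expUnit (-α) * w₀ ^ b = 1 := by
      rw [← expUnit_log (w₀ ^ b)]
      ext
      simp only [expUnit, Units.val_mul, Units.val_mk0, ← Complex.exp_add]
      simp [α]
    have e2 : expUnit (-β) * w₀ ^ (-a) = 1 := by
      rw [← expUnit_log (w₀ ^ (-a))]
      ext
      simp only [expUnit, Units.val_mul, Units.val_mk0, ← Complex.exp_add]
      simp [β]
    rw [hKrange, ← Set.range_comp]
    unfold standardTorusKnot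
    congr 1
    funext z
    simp only [Function.comp, Homeomorph.coe_mulLeft, γ, Prod.mk_mul_mk, ← mul_assoc]
    simp only [Set.Icc.coe_one, Complex.ofReal_one, one_mul, e1, e2]
  · intro u
    refine ⟨‖((γ u).1 * w₀ ^ b : ℂˣ).val‖, ‖((γ u).2 * w₀ ^ (-a) : ℂˣ).val‖, ?_⟩
    rw [hKrange, ← Set.range_comp]
    rintro _ ⟨z, rfl⟩
    constructor <;> simp [-Circle.coe_pow, Circle.norm_coe]

/-- The topological part of the main theorem, for sets which are products in monomial
coordinates. -/
theorem topology_of_monomialCoordinates (s n : ℕ) (a b : ℤ) (h : a * (s : ℤ) + b * (n : ℤ) = 1)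
    (w₀ : ℂˣ) (V U : Set TrinomialSpace)
    (hV : V = monomialCoordinates s n a b h ⁻¹' ({w₀} ×ˢ Set.univ))
    (hU : Uᶜ = monomialCoordinates s n a b h ⁻¹' (unitSegment w₀ ×ˢ Set.univ)) :
    IsDeformationRetract V Uᶜ ∧
    (∃ K : Set TrinomialSpace, IsDeformationRetract K V ∧ IsTorusKnot n s K) ∧
    IsConnected V ∧ ¬ IsSimplyConnected V ∧
    (∀ x : V, Nonempty (FundamentalGroup V x ≃* Multiplicative ℤ)) ∧
    IsConnected U ∧
    (∀ x : U, Nonempty (FundamentalGroup U x ≃* Multiplicative (ℤ × ℤ))) := by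
  set e := monomialCoordinates s n a b h
  have hU' : U = e ⁻¹' ((unitSegment w₀)ᶜ ×ˢ Set.univ) := by
    rw [← compl_compl U, hU]
    ext x
    simp
  have eV : ContinuousMap.HomotopyEquiv V ℂˣ :=
    hV ▸ (homeomorphPreimageSingletonProd e w₀).toHomotopyEquiv
  have eU : ContinuousMap.HomotopyEquiv U (ℂˣ × ℂˣ) :=
    hU' ▸ (homeomorphPreimageProd e _).toHomotopyEquiv.trans
      ((unitSegmentComplEquiv w₀).prodCongr (.refl ℂˣ))
  have hπV (x : V) : Nonempty (FundamentalGroup V x ≃* Multiplicative ℤ) := by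
    obtain ⟨y, ⟨f⟩⟩ := eV.fundamentalGroup x
    obtain ⟨g⟩ := fundamentalGroup_complexUnits y
    exact ⟨f.trans g⟩
  have := eV.pathConnectedSpace
  have := eU.pathConnectedSpace
  refine ⟨?_, ⟨_, ?_, isTorusKnot_preimage s n a b h w₀⟩,
    isConnected_iff_connectedSpace.2 inferInstance, ?_, hπV,
    isConnected_iff_connectedSpace.2 inferInstance, ?_⟩
  · rw [hU, hV]
    exact (isDeformationRetract_unitSegment w₀).preimage e
  · rw [hV]
    exact (isDeformationRetract_unitCircle w₀).preimage e
  · intro hs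
    have := hs.simplyConnectedSpace
    obtain ⟨x⟩ : Nonempty V := inferInstance
    obtain ⟨f⟩ := hπV x
    have := f.symm.injective.subsingleton
    exact not_subsingleton (Multiplicative ℤ) this
  · intro x
    obtain ⟨⟨y, z⟩, ⟨f⟩⟩ := eU.fundamentalGroup x
    obtain ⟨g⟩ := fundamentalGroup_prod y z
    obtain ⟨g1⟩ := fundamentalGroup_complexUnits y
    obtain ⟨g2⟩ := fundamentalGroup_complexUnits z
    exact ⟨(f.trans g).trans ((g1.prodCongr g2).trans (MulEquiv.prodMultiplicative ℤ ℤ).symm)⟩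

end Topology

noncomputable section Polynomials

open Polynomial hiding trinomial

theorem countP_le_of_sort_getD_ne {M : Multiset ℝ} {t : ℕ} (ht : 0 < t) (htM : t < M.card)
    (h : M.sort.getD (t - 1) 0 ≠ M.sort.getD t 0) : ∃ r, M.countP (· ≤ r) = t := by
  set l := M.sort with hl
  have hlen : l.length = M.card := Multiset.length_sort ..
  have hs : l.Pairwise (· ≤ ·) := Multiset.pairwise_sort ..
  have hM : (l : Multiset ℝ) = M := Multiset.sort_eq ..
  have hmono := List.pairwise_iff_getElem.1 hs
  have h1 : t - 1 < l.length := by omega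
  have h2 : t < l.length := by omega
  rw [List.getD_eq_getElem _ _ h1, List.getD_eq_getElem _ _ h2] at h
  have hlt : l[t - 1] < l[t] := lt_of_le_of_ne (hmono _ _ h1 h2 (by omega)) h
  refine ⟨l[t - 1], ?_⟩
  have he : l.countP (fun x => decide (x ≤ l[t - 1])) =
      (l.take t).countP (fun x => decide (x ≤ l[t - 1])) +
      (l.drop t).countP (fun x => decide (x ≤ l[t - 1])) := by
    rw [← List.countP_append, List.take_append_drop]
  rw [← hM, Multiset.coe_countP, he, List.countP_eq_length.2, List.countP_eq_zero.2]
  · simp [h2.le]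
  · intro x hx
    obtain ⟨i, hi, rfl⟩ := List.mem_iff_getElem.1 hx
    rw [List.getElem_drop, decide_eq_true_eq, not_le]
    refine hlt.trans_le ?_
    rcases Nat.eq_zero_or_pos i with rfl | hi'
    · simp
    · exact hmono _ _ _ _ (by omega)
  · intro x hx
    obtain ⟨i, hi, rfl⟩ := List.mem_iff_getElem.1 hx
    rw [List.getElem_take, decide_eq_true_eq]
    rw [List.length_take] at hi
    rcases Nat.lt_or_ge i (t - 1) with hi' | hi'
    · exact hmono _ _ _ _ hi'
    · have : i = t - 1 := by omega
      simp [this]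

theorem countP_lt_of_sort_getD_eq {M : Multiset ℝ} {t : ℕ} (ht : 0 < t) (htM : t < M.card)
    (h : M.sort.getD (t - 1) 0 = M.sort.getD t 0) :
    ∃ r, M.countP (· < r) < t ∧ t < M.countP (· ≤ r) := by
  set l := M.sort with hl
  have hlen : l.length = M.card := Multiset.length_sort ..
  have hs : l.Pairwise (· ≤ ·) := Multiset.pairwise_sort ..
  have hM : (l : Multiset ℝ) = M := Multiset.sort_eq ..
  have hmono := List.pairwise_iff_getElem.1 hs
  have h1 : t - 1 < l.length := by omega
  have h2 : t < l.length := by omega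
  rw [List.getD_eq_getElem _ _ h1, List.getD_eq_getElem _ _ h2] at h
  refine ⟨l[t], ?_, ?_⟩
  · have hd : (l.drop (t - 1)).countP (fun x => decide (x < l[t])) = 0 := by
      rw [List.countP_eq_zero]
      intro x hx
      obtain ⟨i, hi, rfl⟩ := List.mem_iff_getElem.1 hx
      rw [List.getElem_drop, decide_eq_true_eq, not_lt, ← h]
      rcases Nat.eq_zero_or_pos i with rfl | hi'
      · simp
      · exact hmono _ _ _ _ (by omega)
    have he : l.countP (fun x => decide (x < l[t])) =
        (l.take (t - 1)).countP (fun x => decide (x < l[t])) +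
        (l.drop (t - 1)).countP (fun x => decide (x < l[t])) := by
      rw [← List.countP_append, List.take_append_drop]
    have hle := List.countP_le_length (p := fun x => decide (x < l[t])) (l := l.take (t - 1))
    rw [List.length_take] at hle
    rw [← hM, Multiset.coe_countP, he]
    omega
  · have hd : (l.take (t + 1)).countP (fun x => decide (x ≤ l[t])) = (l.take (t + 1)).length := by
      rw [List.countP_eq_length]
      intro x hx
      obtain ⟨i, hi, rfl⟩ := List.mem_iff_getElem.1 hx
      rw [List.getElem_take, decide_eq_true_eq]
      rw [List.length_take] at hi
      rcases Nat.lt_or_ge i t with hi' | hi'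
      · exact hmono _ _ _ _ hi'
      · have : i = t := by omega
        simp [this]
    have he : l.countP (fun x => decide (x ≤ l[t])) =
        (l.take (t + 1)).countP (fun x => decide (x ≤ l[t])) +
        (l.drop (t + 1)).countP (fun x => decide (x ≤ l[t])) := by
      rw [← List.countP_append, List.take_append_drop]
    rw [List.length_take] at hd
    rw [← hM, Multiset.coe_countP, he]
    omega

/-- The argument principle for sums of simple fractions. -/
theorem circleIntegral_sum_inv_sub {r : ℝ} (hr : 0 < r) (M : Multiset ℂ)
    (hM : ∀ ζ ∈ M, ‖ζ‖ ≠ r) :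
    CircleIntegrable (fun z => (M.map fun ζ => 1 / (z - ζ)).sum) 0 r ∧
    ∮ z in C(0, r), (M.map fun ζ => 1 / (z - ζ)).sum =
      M.countP (‖·‖ < r) * (2 * Real.pi * Complex.I) := by
  induction M using Multiset.induction_on with
  | empty => simp [circleIntegral]
  | cons ζ M ih =>
    obtain ⟨ih1, ih2⟩ := ih fun ζ hζ => hM ζ (Multiset.mem_cons_of_mem hζ)
    have hζ := hM ζ (Multiset.mem_cons_self ζ M)
    have hi : CircleIntegrable (fun z => 1 / (z - ζ)) 0 r := by
      simp_rw [one_div]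
      rw [circleIntegrable_sub_inv_iff]
      right
      simpa [abs_of_pos hr] using hζ
    simp only [Multiset.map_cons, Multiset.sum_cons]
    refine ⟨hi.add ih1, ?_⟩
    rw [circleIntegral.integral_add hi ih1, ih2]
    by_cases hlt : ‖ζ‖ < r
    · rw [Multiset.countP_cons_of_pos (p := fun x : ℂ => ‖x‖ < r) _ hlt]
      simp_rw [one_div]
      rw [circleIntegral.integral_sub_inv_of_mem_ball (by simpa using hlt)]
      push_cast
      ring
    · rw [Multiset.countP_cons_of_neg (p := fun x : ℂ => ‖x‖ < r) _ hlt]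
      rw [Complex.circleIntegral_eq_zero_of_differentiable_on_off_countable hr.le
        (s := ∅) Set.countable_empty, zero_add]
      · intro z hz
        refine ContinuousAt.continuousWithinAt ?_
        have : z - ζ ≠ 0 := by
          intro h
          rw [sub_eq_zero] at h
          simp at hz
          subst h
          exact hζ (le_antisymm hz (not_lt.1 hlt))
        fun_prop (disch := assumption)
      · rintro z ⟨hz, -⟩
        have : z - ζ ≠ 0 := by
          intro h
          rw [sub_eq_zero] at h
          simp at hz
          subst h
          exact hlt hz
        fun_prop (disch := assumption)

/-- A polynomial which on a circle is dominated by one monomial of degree `t` has `t` roots inside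
the circle. -/
theorem countP_roots_of_dominant {P : ℂ[X]} {r : ℝ} (hr : 0 < r) (a : ℂ) (t : ℕ)
    (h : ∀ z : ℂ, ‖z‖ = r → ‖P.eval z - a * z ^ t‖ < ‖a * z ^ t‖) :
    (∀ z ∈ P.roots, ‖z‖ ≠ r) ∧ P.roots.countP (‖·‖ < r) = t := by
  have hP (z : ℂ) (hz : ‖z‖ = r) : P.eval z ≠ 0 := by
    intro h0
    have := h z hz
    simp [h0] at this
  have hroots : ∀ z ∈ P.roots, ‖z‖ ≠ r := fun z hz hzr => hP z hzr (isRoot_of_mem_roots hz)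
  refine ⟨hroots, ?_⟩
  obtain ⟨hi, hI⟩ := circleIntegral_sum_inv_sub hr P.roots hroots
  have key : ∮ z in C(0, r), ((P.roots.map fun ζ => 1 / (z - ζ)).sum - t * (z - 0)⁻¹) = 0 := by
    refine circleIntegral.integral_eq_zero_of_hasDerivWithinAt hr.le
      (f := fun z => Complex.log (P.eval z / (a * z ^ t))) fun z hz => ?_
    have hz : ‖z‖ = r := by simpa using hz
    have hz0 : z ≠ 0 := by
      rintro rfl
      simp at hz
      exact hr.ne hz
    have hat : a * z ^ t ≠ 0 := by
      intro h0
      have := h z hz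
      rw [h0, norm_zero] at this
      exact absurd this (norm_nonneg _).not_gt
    have ha : a ≠ 0 := left_ne_zero_of_mul hat
    have hslit : P.eval z / (a * z ^ t) ∈ Complex.slitPlane := by
      have h1 : ‖P.eval z / (a * z ^ t) - 1‖ < 1 := by
        rw [div_sub_one hat, norm_div, div_lt_one (norm_pos_iff.2 hat)]
        exact h z hz
      left
      have h2 := (Complex.abs_re_le_norm _).trans_lt h1
      rw [abs_lt] at h2
      simp only [Complex.sub_re, Complex.one_re] at h2
      linarith
    have hd : HasDerivAt (fun z => P.eval z / (a * z ^ t)) _ z :=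
      (P.hasDerivAt z).div ((hasDerivAt_pow t z).const_mul a) hat
    convert (hd.clog hslit).hasDerivWithinAt using 1
    rw [← (IsAlgClosed.splits P).eval_derivative_div_eval_of_ne_zero (hP z hz)]
    have hPz := hP z hz
    rcases t with _ | t
    · field_simp
      simp [mul_comm]
    · field_simp
      simp
      ring
  have hi2 : CircleIntegrable (fun z : ℂ => (t : ℂ) * (z - 0)⁻¹) 0 r := by
    refine CircleIntegrable.const_smul (a := (t : ℂ)) ?_
    rw [circleIntegrable_sub_inv_iff]
    right
    simpa [abs_of_pos hr] using hr.ne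
  rw [circleIntegral.integral_sub hi hi2, hI, circleIntegral.integral_const_mul,
    circleIntegral.integral_sub_center_inv _ hr.ne', ← sub_mul] at key
  have h2 : (2 * Real.pi * Complex.I : ℂ) ≠ 0 := by simp [Real.pi_ne_zero]
  have := (mul_eq_zero.1 key).resolve_right h2
  rw [sub_eq_zero] at this
  exact_mod_cast this

/-- The parity of the number of roots of a real polynomial in a disc. -/
theorem even_countP_roots_iff {r : ℝ} (hr : 0 < r) (P : ℝ[X]) (h1 : P.eval r ≠ 0)
    (h2 : P.eval (-r) ≠ 0) :
    Even ((P.map Complex.ofRealHom).roots.countP (‖·‖ < r)) ↔ 0 < P.eval r * P.eval (-r) := by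
  induction hn : P.natDegree using Nat.strong_induction_on generalizing P with
  | _ n ih =>
  have hP : P ≠ 0 := by rintro rfl; simp at h1
  have hmap (Q : ℝ[X]) (hQ : Q ≠ 0) : Q.map Complex.ofRealHom ≠ 0 := by
    rwa [Ne, Polynomial.map_eq_zero_iff Complex.ofRealHom.injective]
  have step (Q R : ℝ[X]) (hQR : P = Q * R) (hQ : 0 < Q.natDegree)
      (h : Even ((Q.map Complex.ofRealHom).roots.countP (‖·‖ < r)) ↔
        0 < Q.eval r * Q.eval (-r)) :
      Even ((P.map Complex.ofRealHom).roots.countP (‖·‖ < r)) ↔ 0 < P.eval r * P.eval (-r) := by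
    subst hQR
    have hQ0 := left_ne_zero_of_mul hP
    have hR0 := right_ne_zero_of_mul hP
    rw [eval_mul] at h1 h2
    have hR := ih R.natDegree (by rw [← hn, natDegree_mul hQ0 hR0]; omega) R
      (right_ne_zero_of_mul h1) (right_ne_zero_of_mul h2) rfl
    have hQ1 : Q.eval r * Q.eval (-r) ≠ 0 :=
      mul_ne_zero (left_ne_zero_of_mul h1) (left_ne_zero_of_mul h2)
    have hR1 : R.eval r * R.eval (-r) ≠ 0 :=
      mul_ne_zero (right_ne_zero_of_mul h1) (right_ne_zero_of_mul h2)
    rw [Polynomial.map_mul, roots_mul (mul_ne_zero (hmap _ hQ0) (hmap _ hR0)),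
      Multiset.countP_add, Nat.even_add, h, hR, eval_mul, eval_mul, mul_mul_mul_comm]
    rcases lt_or_gt_of_ne hQ1 with hQ1 | hQ1 <;> rcases lt_or_gt_of_ne hR1 with hR1 | hR1
    · simp [hQ1.not_gt, hR1.not_gt, mul_pos_of_neg_of_neg hQ1 hR1]
    · simp [hQ1.not_gt, hR1, (mul_neg_of_neg_of_pos hQ1 hR1).not_gt]
    · simp [hQ1, hR1.not_gt, (mul_neg_of_pos_of_neg hQ1 hR1).not_gt]
    · simp [hQ1, hR1, mul_pos hQ1 hR1]
  rcases Nat.eq_zero_or_pos P.natDegree with hdeg | hdeg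
  · rw [eq_C_of_natDegree_eq_zero hdeg] at h1 ⊢
    simp only [eval_C] at h1
    simp [mul_self_pos, h1]
  obtain ⟨z, hz⟩ := IsAlgClosed.exists_aeval_eq_zero ℂ P (by
    rw [degree_eq_natDegree hP]
    exact_mod_cast hdeg.ne')
  by_cases him : z.im = 0
  · have hroot : P.eval z.re = 0 := by
      have hzre : z = (z.re : ℂ) := Complex.ext rfl (by simp [him])
      rw [hzre, ← Complex.coe_algebraMap, aeval_algebraMap_apply] at hz
      simpa using hz
    obtain ⟨R, hR⟩ := dvd_iff_isRoot.2 hroot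
    refine step _ R hR (by simp) ?_
    have hre1 : z.re ≠ r := fun h => h1 (h ▸ hroot)
    have hre2 : z.re ≠ -r := fun h => h2 (h ▸ hroot)
    have hev : (X - C z.re).eval r * (X - C z.re).eval (-r) = z.re ^ 2 - r ^ 2 := by
      simp
      ring
    rw [hev, sub_pos, sq_lt_sq, abs_of_pos hr]
    have : (map Complex.ofRealHom (X - C z.re)).roots = {(z.re : ℂ)} := by simp
    rw [this, ← Multiset.cons_zero, Multiset.countP_cons, Complex.norm_real, Real.norm_eq_abs]
    have hne : |z.re| ≠ r := by
      intro h
      rcases eq_or_eq_neg_of_abs_eq h with h | h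
      exacts [hre1 h, hre2 h]
    rcases lt_or_gt_of_ne hne with h | h
    · simp [h, h.not_gt]
    · simp [h, h.not_gt]
  · obtain ⟨R, hR⟩ := P.quadratic_dvd_of_aeval_eq_zero_im_ne_zero hz him
    have hfac : (X ^ 2 - C (2 * z.re) * X + C (‖z‖ ^ 2) : ℝ[X]).map Complex.ofRealHom =
        (X - C z) * (X - C (starRingEnd ℂ z)) := by
      have e1 : (2 * z.re : ℂ) = z + starRingEnd ℂ z := by rw [Complex.add_conj]; push_cast; ring
      have e1' := congrArg (C : ℂ → ℂ[X]) e1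
      rw [C_add, C_mul] at e1'
      have e2 : ((‖z‖ : ℂ)) ^ 2 = z * starRingEnd ℂ z := by rw [Complex.mul_conj']
      simp only [Polynomial.map_add, Polynomial.map_sub, Polynomial.map_mul, Polynomial.map_pow,
        map_X, map_C, Complex.ofRealHom_eq_coe, Complex.ofReal_ofNat,
        Complex.ofReal_pow, e2, C_mul]
      linear_combination (-X) * e1'
    refine step _ R hR ?_ ?_
    · have : (X ^ 2 - C (2 * z.re) * X + C (‖z‖ ^ 2) : ℝ[X]).natDegree = 2 := by compute_degree!
      omega
    · rw [hfac, roots_mul (mul_ne_zero (X_sub_C_ne_zero _) (X_sub_C_ne_zero _)),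
        roots_X_sub_C, roots_X_sub_C, Multiset.countP_add]
      have : ({starRingEnd ℂ z} : Multiset ℂ).countP (‖·‖ < r) =
          ({z} : Multiset ℂ).countP (‖·‖ < r) := by
        simp only [← Multiset.cons_zero, Multiset.countP_cons, RCLike.norm_conj]
      rw [this]
      refine iff_of_true (Even.add_self _) ?_
      have hq (x : ℝ) : 0 < (X ^ 2 - C (2 * z.re) * X + C (‖z‖ ^ 2) : ℝ[X]).eval x := by
        have : ‖z‖ ^ 2 = z.re ^ 2 + z.im ^ 2 := by
          rw [← Complex.normSq_eq_norm_sq, Complex.normSq_apply]; ring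
        simp only [eval_add, eval_sub, eval_mul, eval_pow, eval_X, eval_C, this]
        have := sq_nonneg (x - z.re)
        have := pow_pos (abs_pos.2 him) 2
        rw [sq_abs] at this
        linarith
      exact mul_pos (hq _) (hq _)

/-- The invariant `p ^ (s + t) / q ^ s` of a trinomial under scaling of the variable. -/
def trinomialInvariant (s t : ℕ) (x : TrinomialSpace) : ℂ := (x.1 : ℂ) ^ (s + t) / (x.2 : ℂ) ^ s

/-- The value of the invariant at the trinomials with a multiple root. -/
def discriminantValue (s t : ℕ) : ℝ := (-1) ^ (s + t) * (s + t : ℕ) ^ (s + t) / (t ^ t * s ^ s)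

theorem eval_trinomial (s t : ℕ) (x : TrinomialSpace) (z : ℂ) :
    (trinomial s t x).eval z = z ^ (s + t) + x.1 * z ^ t + x.2 := by
  simp [trinomial]

theorem natDegree_trinomial' {s t : ℕ} (hs : 0 < s) (x : TrinomialSpace) :
    (trinomial s t x).natDegree = s + t := by
  unfold trinomial
  compute_degree!
  simp [hs.ne']

theorem trinomial_monic {s t : ℕ} (hs : 0 < s) (x : TrinomialSpace) :
    (trinomial s t x).Monic := by
  unfold trinomial
  monicity!
  simp [hs.ne']

theorem trinomial_ne_zero {s t : ℕ} (hs : 0 < s) (x : TrinomialSpace) : trinomial s t x ≠ 0 :=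
  (trinomial_monic hs x).ne_zero

theorem card_roots_trinomial {s t : ℕ} (hs : 0 < s) (x : TrinomialSpace) :
    (trinomial s t x).roots.card = s + t := by
  rw [← (IsAlgClosed.splits _).natDegree_eq_card_roots, natDegree_trinomial' hs]

theorem mem_roots_trinomial {s t : ℕ} (hs : 0 < s) {x : TrinomialSpace} {z : ℂ} :
    z ∈ (trinomial s t x).roots ↔ z ^ (s + t) + x.1 * z ^ t + x.2 = 0 := by
  rw [mem_roots (trinomial_ne_zero hs x), IsRoot, eval_trinomial]

theorem ne_zero_of_mem_roots_trinomial {s t : ℕ} (hs : 0 < s) (ht : 0 < t) {x : TrinomialSpace}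
    {z : ℂ} (hz : z ∈ (trinomial s t x).roots) : z ≠ 0 := by
  rintro rfl
  rw [mem_roots_trinomial hs] at hz
  simp [ht.ne'] at hz

/-- Scaling the variable by `l` acts on coefficient pairs. -/
def scaleTrinomial (s t : ℕ) (l : ℂˣ) (x : TrinomialSpace) : TrinomialSpace :=
  (l ^ s * x.1, l ^ (s + t) * x.2)

theorem roots_scaleTrinomial {s t : ℕ} (hs : 0 < s) (ht : 0 < t) (l : ℂˣ) (x : TrinomialSpace) :
    (trinomial s t (scaleTrinomial s t l x)).roots =
      (trinomial s t x).roots.map fun z => (l : ℂ) * z := by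
  rw [← roots_scaleRoots _ l.isUnit]
  congr 1
  ext i
  rw [coeff_scaleRoots, natDegree_trinomial' hs]
  simp only [trinomial, scaleTrinomial, coeff_add, coeff_C_mul, coeff_X_pow, coeff_C]
  by_cases h1 : i = s + t
  · subst h1
    simp [hs.ne', ht.ne']
  by_cases h2 : i = t
  · subst h2
    simp [hs.ne', ht.ne', mul_comm]
  by_cases h3 : i = 0
  · subst h3
    simp [h1, h2, mul_comm]
  · simp [h1, h2, h3]

theorem trinomialInvariant_eq_monomialCoordinates {s t : ℕ} {a b : ℤ}
    (hab : a * (s : ℤ) + b * ((s + t : ℕ) : ℤ) = 1) (x : TrinomialSpace) :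
    (((monomialCoordinates s (s + t : ℕ) a b hab x).1 : ℂˣ) : ℂ) = trinomialInvariant s t x := by
  change ((x.1 ^ ((s + t : ℕ) : ℤ) * x.2 ^ (-(s : ℤ)) : ℂˣ) : ℂ) = _
  rw [zpow_neg, zpow_natCast, zpow_natCast]
  simp [trinomialInvariant, div_eq_mul_inv]

theorem exists_scaleTrinomial_eq {s t : ℕ} (hst : Nat.Coprime s t) {x y : TrinomialSpace}
    (h : trinomialInvariant s t x = trinomialInvariant s t y) :
    ∃ l : ℂˣ, scaleTrinomial s t l x = y := by
  obtain ⟨a, b, hab⟩ : ∃ a b : ℤ, a * (s : ℤ) + b * ((s + t : ℕ) : ℤ) = 1 := by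
    obtain ⟨a, b, hab⟩ := Nat.isCoprime_iff_coprime.2 hst
    exact ⟨a - b, b, by push_cast; linarith⟩
  let e := monomialCoordinates s (s + t : ℕ) a b hab
  have h1 : (e x).1 = (e y).1 := Units.ext (by
    rw [trinomialInvariant_eq_monomialCoordinates, trinomialInvariant_eq_monomialCoordinates, h])
  have hsymm (x : TrinomialSpace) : ((e x).1 ^ b * (e x).2 ^ s, (e x).1 ^ (-a) * (e x).2 ^ (s + t))
      = x := by
    conv_rhs => rw [← e.symm_apply_apply x]
    change _ = ((e x).1 ^ b * (e x).2 ^ (s : ℤ), (e x).1 ^ (-a) * (e x).2 ^ ((s + t : ℕ) : ℤ))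
    rw [zpow_natCast, zpow_natCast]
  refine ⟨(e y).2 * (e x).2⁻¹, ?_⟩
  have hx1 : (e x).1 ^ b * (e x).2 ^ s = x.1 := congrArg Prod.fst (hsymm x)
  have hx2 : (e x).1 ^ (-a) * (e x).2 ^ (s + t) = x.2 := congrArg Prod.snd (hsymm x)
  have hy1 : (e y).1 ^ b * (e y).2 ^ s = y.1 := congrArg Prod.fst (hsymm y)
  have hy2 : (e y).1 ^ (-a) * (e y).2 ^ (s + t) = y.2 := congrArg Prod.snd (hsymm y)
  refine Prod.ext ?_ ?_
  · change ((e y).2 * (e x).2⁻¹) ^ s * x.1 = y.1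
    rw [← hx1, ← hy1, mul_pow, inv_pow, h1,
      mul_comm ((e y).1 ^ b), mul_comm ((e y).1 ^ b), mul_assoc,
      inv_mul_cancel_left]
  · change ((e y).2 * (e x).2⁻¹) ^ (s + t) * x.2 = y.2
    rw [← hx2, ← hy2, mul_pow, inv_pow, h1,
      mul_comm ((e y).1 ^ (-a)), mul_comm ((e y).1 ^ (-a)), mul_assoc,
      inv_mul_cancel_left]

/-! ### The discriminant -/

theorem discr_trinomial_eq_zero_iff {s t : ℕ} (hs : 0 < s) (ht : 0 < t) (x : TrinomialSpace) :
    (trinomial s t x).discr = 0 ↔ ¬ (trinomial s t x).Separable := by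
  have hdeg := natDegree_trinomial' (t := t) hs x
  have h := resultant_deriv (f := trinomial s t x) (by
    rw [← natDegree_pos_iff_degree_pos, hdeg]; omega)
  rw [← natDegree_derivative, (trinomial_monic hs x).leadingCoeff, mul_one] at h
  rw [separable_def, ← (iff_of_eq (true_and _) : (True ∧ ¬ IsCoprime _ _) ↔ _),
    ← (iff_true_intro (Or.inl (trinomial_ne_zero hs x)) :
      ((trinomial s t x) ≠ 0 ∨ derivative (trinomial s t x) ≠ 0) ↔ True),
    ← resultant_eq_zero_iff, h]
  simp

theorem separable_trinomial_iff {s t : ℕ} (ht : 0 < t) (x : TrinomialSpace) :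
    (trinomial s t x).Separable ↔ ∀ z : ℂ, z ^ (s + t) + x.1 * z ^ t + x.2 = 0 →
      (s + t : ℕ) * z ^ (s + t) + t * (x.1 * z ^ t) ≠ 0 := by
  rw [separable_def, isCoprime_iff_aeval_ne_zero_of_isAlgClosed (K := ℂ) (k := ℂ)]
  refine forall_congr' fun z => ?_
  rw [coe_aeval_eq_eval, eval_trinomial, ← imp_iff_not_or]
  refine imp_congr_right fun hz => not_congr ?_
  have hz0 : z ≠ 0 := by
    rintro rfl
    simp [ht.ne'] at hz
  have : z * (derivative (trinomial s t x)).eval z =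
      (s + t : ℕ) * z ^ (s + t) + t * (x.1 * z ^ t) := by
    obtain ⟨t, rfl⟩ := Nat.exists_eq_succ_of_ne_zero ht.ne'
    simp [trinomial, ← add_assoc]
    ring
  rw [← this, mul_eq_zero]
  simp [hz0]

theorem discr_trinomial_eq_zero_iff_invariant {s t : ℕ} (hs : 0 < s) (ht : 0 < t)
    (hst : Nat.Coprime s t) (x : TrinomialSpace) :
    (trinomial s t x).discr = 0 ↔ trinomialInvariant s t x = discriminantValue s t := by
  have hs' : (s : ℂ) ≠ 0 := by exact_mod_cast hs.ne'
  have ht' : (t : ℂ) ≠ 0 := by exact_mod_cast ht.ne'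
  have hn' : ((s + t : ℕ) : ℂ) ≠ 0 := by exact_mod_cast (by omega : s + t ≠ 0)
  rw [discr_trinomial_eq_zero_iff hs ht, separable_trinomial_iff ht]
  push Not
  constructor
  · rintro ⟨z, h1, h2⟩
    have hq := x.2.ne_zero
    have h3 : (s : ℂ) * z ^ (s + t) = t * x.2 := by
      push_cast at h2
      linear_combination h2 - t * h1
    have h4 : (s : ℂ) * (x.1 * z ^ t) = -((s + t : ℕ) * x.2) := by
      push_cast at h2 ⊢
      linear_combination (s + t) * h1 - h2
    have h5 := congrArg (· ^ t) h3
    have h6 := congrArg (· ^ (s + t)) h4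
    have hz0 : z ≠ 0 := by
      rintro rfl
      simp [ht.ne'] at h1
    simp only [mul_pow, ← pow_mul] at h5 h6
    rw [neg_pow, mul_pow] at h6
    rw [mul_comm (s + t) t] at h5
    have hz : z ^ (t * (s + t)) ≠ 0 := pow_ne_zero _ hz0
    have key : (x.1 : ℂ) ^ (s + t) * (t ^ t * s ^ s) =
        (-1) ^ (s + t) * ((s + t : ℕ) : ℂ) ^ (s + t) * x.2 ^ s := by
      have hqt : (x.2 : ℂ) ^ t ≠ 0 := pow_ne_zero _ hq
      apply mul_right_cancel₀ hqt
      calc _ = (x.1 : ℂ) ^ (s + t) * s ^ s * (t ^ t * x.2 ^ t) := by ring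
        _ = s ^ (s + t) * ((x.1 : ℂ) ^ (s + t) * z ^ (t * (s + t))) := by rw [← h5]; ring
        _ = _ := by rw [h6]; ring
    rw [trinomialInvariant, discriminantValue]
    push_cast at key ⊢
    rw [div_eq_div_iff (pow_ne_zero _ hq) (by positivity), key]
  · intro h
    let y : TrinomialSpace := (Units.mk0 (-((s + t : ℕ) / t : ℂ)) (by
      rw [neg_ne_zero]; exact div_ne_zero hn' ht'), Units.mk0 (s / t : ℂ) (div_ne_zero hs' ht'))
    have hy : trinomialInvariant s t y = discriminantValue s t := by
      simp only [trinomialInvariant, discriminantValue, y, Units.val_mk0]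
      rw [neg_pow, div_pow, div_pow]
      push_cast at hn' ⊢
      field_simp
      ring
    obtain ⟨l, rfl⟩ := exists_scaleTrinomial_eq hst (hy.trans h.symm)
    refine ⟨l, ?_, ?_⟩
    · simp only [scaleTrinomial, y, Units.val_mul, Units.val_pow_eq_pow_val, Units.val_mk0]
      push_cast
      field_simp
      ring
    · simp only [scaleTrinomial, y, Units.val_mul, Units.val_pow_eq_pow_val, Units.val_mk0]
      push_cast
      field_simp
      ring

/-- Some disc around the origin contains exactly `t` roots. -/
def HasGap (s t : ℕ) (x : TrinomialSpace) : Prop :=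
  ∃ r : ℝ, (trinomial s t x).roots.countP (‖·‖ ≤ r) = t

/-- Some circle around the origin contains both the `t`-th and the `(t + 1)`-st root. -/
def IsPinched (s t : ℕ) (x : TrinomialSpace) : Prop :=
  ∃ r : ℝ, (trinomial s t x).roots.countP (‖·‖ < r) < t ∧
    t < (trinomial s t x).roots.countP (‖·‖ ≤ r)

theorem Multiset.countP_le_countP_of_imp {α : Type*} {p q : α → Prop} [DecidablePred p]
    [DecidablePred q] (M : Multiset α) (h : ∀ a ∈ M, p a → q a) : M.countP p ≤ M.countP q := by
  rw [Multiset.countP_eq_card_filter, Multiset.countP_eq_card_filter]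
  refine Multiset.card_le_card (Multiset.le_filter.2 ⟨Multiset.filter_le _ _, fun a ha => ?_⟩)
  exact h a (Multiset.mem_of_mem_filter ha) (Multiset.of_mem_filter ha)

theorem IsPinched.not_hasGap {s t : ℕ} {x : TrinomialSpace} (h : IsPinched s t x) :
    ¬ HasGap s t x := by
  rintro ⟨r, hr⟩
  obtain ⟨ρ, h1, h2⟩ := h
  rcases lt_or_ge r ρ with hlt | hle
  · have := (trinomial s t x).roots.countP_le_countP_of_imp (p := fun z => ‖z‖ ≤ r)
      (q := fun z => ‖z‖ < ρ) fun z _ hz => lt_of_le_of_lt hz hlt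
    omega
  · have := (trinomial s t x).roots.countP_le_countP_of_imp (p := fun z => ‖z‖ ≤ ρ)
      (q := fun z => ‖z‖ ≤ r) fun z _ hz => le_trans hz hle
    omega

theorem hasGap_or_isPinched {s t : ℕ} (hs : 0 < s) (ht : 0 < t) (x : TrinomialSpace) :
    (rootNorm s t x t ≠ rootNorm s t x (t + 1) ∧ HasGap s t x) ∨
      (rootNorm s t x t = rootNorm s t x (t + 1) ∧ IsPinched s t x) := by
  have hcard : t < ((trinomial s t x).roots.map fun z => ‖z‖).card := by
    rw [Multiset.card_map, card_roots_trinomial hs]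
    omega
  by_cases h : rootNorm s t x t = rootNorm s t x (t + 1)
  · obtain ⟨r, h1, h2⟩ := countP_lt_of_sort_getD_eq ht hcard h
    rw [Multiset.countP_map, ← Multiset.countP_eq_card_filter] at h1 h2
    exact Or.inr ⟨h, r, h1, h2⟩
  · obtain ⟨r, hr⟩ := countP_le_of_sort_getD_ne ht hcard h
    rw [Multiset.countP_map, ← Multiset.countP_eq_card_filter] at hr
    exact Or.inl ⟨h, r, hr⟩

theorem mem_distinctNormSet_iff_hasGap {s t : ℕ} (hs : 0 < s) (ht : 0 < t) (x : TrinomialSpace) :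
    x ∈ distinctNormSet s t t ↔ HasGap s t x := by
  have h1 : ¬ (t = 0) := ht.ne'
  have h2 : ¬ (t = s + t) := by omega
  simp only [distinctNormSet, Set.mem_ofPred_eq, h1, h2, false_or]
  rcases hasGap_or_isPinched hs ht x with ⟨h, h'⟩ | ⟨h, h'⟩
  · exact iff_of_true h h'
  · exact iff_of_false (not_not.2 h) h'.not_hasGap

theorem isPinched_iff_not_hasGap {s t : ℕ} (hs : 0 < s) (ht : 0 < t) (x : TrinomialSpace) :
    IsPinched s t x ↔ ¬ HasGap s t x := by
  refine ⟨IsPinched.not_hasGap, fun h => ?_⟩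
  rcases hasGap_or_isPinched hs ht x with ⟨-, h'⟩ | ⟨-, h'⟩
  exacts [absurd h' h, h']

theorem HasGap.of_invariant_eq {s t : ℕ} (hs : 0 < s) (ht : 0 < t) (hst : Nat.Coprime s t)
    {x y : TrinomialSpace} (hxy : trinomialInvariant s t x = trinomialInvariant s t y)
    (h : HasGap s t x) : HasGap s t y := by
  obtain ⟨l, rfl⟩ := exists_scaleTrinomial_eq hst hxy
  obtain ⟨r, hr⟩ := h
  refine ⟨‖(l : ℂ)‖ * r, ?_⟩
  rw [roots_scaleTrinomial hs ht, Multiset.countP_map, ← Multiset.countP_eq_card_filter]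
  refine Eq.trans ?_ hr
  refine Multiset.countP_congr (p := fun z : ℂ => ‖(l : ℂ) * z‖ ≤ ‖(l : ℂ)‖ * r)
    (p' := fun z : ℂ => ‖z‖ ≤ r) rfl fun z _ => propext ?_
  rw [norm_mul, mul_le_mul_iff_right₀ (by simp)]

/-! ### Roots of equal norm -/

theorem eq_or_eq_conj_of_norm_eq {X Y : ℂ} (h1 : ‖X‖ = ‖Y‖) (h2 : ‖1 + X‖ = ‖1 + Y‖) :
    Y = X ∨ Y = starRingEnd ℂ X := by
  have e1 : X.re ^ 2 + X.im ^ 2 = Y.re ^ 2 + Y.im ^ 2 := by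
    have := congrArg (· ^ 2) h1
    simp only [← Complex.normSq_eq_norm_sq, Complex.normSq_apply] at this
    linarith
  have e2 : (1 + X.re) ^ 2 + X.im ^ 2 = (1 + Y.re) ^ 2 + Y.im ^ 2 := by
    have := congrArg (· ^ 2) h2
    simp only [← Complex.normSq_eq_norm_sq, Complex.normSq_apply, Complex.add_re, Complex.one_re,
      Complex.add_im, Complex.one_im, zero_add] at this
    linarith
  have hre : Y.re = X.re := by linarith
  have him : Y.im ^ 2 = X.im ^ 2 := by rw [hre] at e1; linarith
  rcases sq_eq_sq_iff_eq_or_eq_neg.1 him with h | h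
  · exact Or.inl (Complex.ext hre h)
  · exact Or.inr (Complex.ext hre (by simpa using h))

theorem eq_of_pow_eq_pow_of_coprime {m n : ℕ} (hmn : Nat.Coprime m n) {z w : ℂ} (hw : w ≠ 0)
    (h1 : z ^ m = w ^ m) (h2 : z ^ n = w ^ n) : z = w := by
  have e1 : (z / w) ^ m = 1 := by rw [div_pow, h1, div_self (pow_ne_zero _ hw)]
  have e2 : (z / w) ^ n = 1 := by rw [div_pow, h2, div_self (pow_ne_zero _ hw)]
  have := pow_gcd_eq_one.2 ⟨e1, e2⟩
  rw [hmn, pow_one, div_eq_one_iff_eq hw] at this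
  exact this

/-- Two roots of a trinomial with equal norm either agree, or have complex conjugate monomials. -/
theorem eq_or_conj_of_roots_norm_eq {s t : ℕ} (hs : 0 < s) (ht : 0 < t) (hst : Nat.Coprime s t)
    {x : TrinomialSpace} {z w : ℂ} (hz : z ∈ (trinomial s t x).roots)
    (hw : w ∈ (trinomial s t x).roots) (hzw : ‖z‖ = ‖w‖) :
    w = z ∨ (w ^ (s + t) / x.2 = starRingEnd ℂ (z ^ (s + t) / x.2) ∧
      x.1 * w ^ t / x.2 = starRingEnd ℂ (x.1 * z ^ t / x.2)) := by
  have hq := x.2.ne_zero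
  have hp := x.1.ne_zero
  have hz0 := ne_zero_of_mem_roots_trinomial hs ht hz
  have hsum {z : ℂ} (hz : z ∈ (trinomial s t x).roots) :
      x.1 * z ^ t / x.2 = -(1 + z ^ (s + t) / x.2) := by
    rw [mem_roots_trinomial hs] at hz
    field_simp
    linear_combination hz
  have hY : ‖(x.1 : ℂ) * z ^ t / x.2‖ = ‖(x.1 : ℂ) * w ^ t / x.2‖ := by simp [hzw]
  rw [hsum hz, hsum hw, norm_neg, norm_neg] at hY
  rcases eq_or_eq_conj_of_norm_eq (X := z ^ (s + t) / x.2) (Y := w ^ (s + t) / x.2)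
    (by simp [hzw]) hY with h | h
  · left
    have h' : x.1 * w ^ t / x.2 = x.1 * z ^ t / x.2 := by rw [hsum hz, hsum hw, h]
    refine eq_of_pow_eq_pow_of_coprime (m := s + t) (n := t) (by simpa using hst) hz0 ?_ ?_
    · exact (div_left_inj' hq).1 h
    · exact mul_left_cancel₀ hp ((div_left_inj' hq).1 h')
  · right
    refine ⟨h, ?_⟩
    rw [hsum hz, hsum hw, h]
    simp

theorem conj_invariant_of_roots_norm_eq {s t : ℕ} (hs : 0 < s) (ht : 0 < t)
    (hst : Nat.Coprime s t) {x : TrinomialSpace} {z w : ℂ} (hz : z ∈ (trinomial s t x).roots)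
    (hw : w ∈ (trinomial s t x).roots) (hzw : ‖z‖ = ‖w‖) (hne : w ≠ z) :
    starRingEnd ℂ (trinomialInvariant s t x) = trinomialInvariant s t x := by
  have hq := x.2.ne_zero
  obtain ⟨h1, h2⟩ := (eq_or_conj_of_roots_norm_eq hs ht hst hz hw hzw).resolve_left hne
  have key (z : ℂ) : trinomialInvariant s t x * (z ^ (s + t) / x.2) ^ t =
      (x.1 * z ^ t / x.2) ^ (s + t) := by
    rw [trinomialInvariant, div_pow, div_pow, mul_pow, ← pow_mul, ← pow_mul, mul_comm t (s + t)]
    rw [div_mul_div_comm, ← pow_add]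
  have hw1 := key w
  rw [h1, h2, ← map_pow, ← map_pow, ← key z, map_mul] at hw1
  refine (mul_right_cancel₀ ?_ hw1).symm
  rw [Ne, map_eq_zero]
  exact pow_ne_zero _ (div_ne_zero (pow_ne_zero _ (ne_zero_of_mem_roots_trinomial hs ht hz)) hq)

/-! ### Dominant monomials -/

theorem countP_roots_of_leading_dominant {s t : ℕ} {x : TrinomialSpace} {r : ℝ} (hr : 0 < r)
    (h : ‖(x.1 : ℂ)‖ * r ^ t + ‖(x.2 : ℂ)‖ < r ^ (s + t)) :
    (∀ z ∈ (trinomial s t x).roots, ‖z‖ ≠ r) ∧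
      (trinomial s t x).roots.countP (‖·‖ < r) = s + t := by
  refine countP_roots_of_dominant hr 1 (s + t) fun z hz => ?_
  rw [eval_trinomial, one_mul, norm_pow, hz]
  refine lt_of_le_of_lt ?_ h
  calc _ = ‖(x.1 : ℂ) * z ^ t + x.2‖ := by congr 1; ring
    _ ≤ _ := (norm_add_le _ _).trans_eq (by rw [norm_mul, norm_pow, hz])

theorem countP_roots_of_middle_dominant {s t : ℕ} {x : TrinomialSpace} {r : ℝ} (hr : 0 < r)
    (h : r ^ (s + t) + ‖(x.2 : ℂ)‖ < ‖(x.1 : ℂ)‖ * r ^ t) :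
    (∀ z ∈ (trinomial s t x).roots, ‖z‖ ≠ r) ∧
      (trinomial s t x).roots.countP (‖·‖ < r) = t := by
  refine countP_roots_of_dominant hr x.1 t fun z hz => ?_
  rw [eval_trinomial, norm_mul, norm_pow, hz]
  refine lt_of_le_of_lt ?_ h
  calc _ = ‖z ^ (s + t) + x.2‖ := by congr 1; ring
    _ ≤ _ := (norm_add_le _ _).trans_eq (by rw [norm_pow, hz])

theorem countP_roots_of_constant_dominant {s t : ℕ} {x : TrinomialSpace} {r : ℝ} (hr : 0 < r)
    (h : r ^ (s + t) + ‖(x.1 : ℂ)‖ * r ^ t < ‖(x.2 : ℂ)‖) :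
    (∀ z ∈ (trinomial s t x).roots, ‖z‖ ≠ r) ∧
      (trinomial s t x).roots.countP (‖·‖ < r) = 0 := by
  refine countP_roots_of_dominant hr x.2 0 fun z hz => ?_
  rw [eval_trinomial, pow_zero, mul_one]
  refine lt_of_le_of_lt ?_ h
  calc _ = ‖z ^ (s + t) + x.1 * z ^ t‖ := by congr 1; ring
    _ ≤ _ := (norm_add_le _ _).trans_eq (by rw [norm_mul, norm_pow, norm_pow, hz])

/-! ### Real trinomials -/

/-- The coefficient pair of a real trinomial. -/
def realTrinomial (p q : ℝ) (hp : p ≠ 0) (hq : q ≠ 0) : TrinomialSpace :=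
  (Units.mk0 (p : ℂ) (by exact_mod_cast hp), Units.mk0 (q : ℂ) (by exact_mod_cast hq))

theorem trinomialInvariant_realTrinomial (s t : ℕ) {p q : ℝ} (hp : p ≠ 0) (hq : q ≠ 0) :
    trinomialInvariant s t (realTrinomial p q hp hq) = ((p ^ (s + t) / q ^ s : ℝ) : ℂ) := by
  simp [trinomialInvariant, realTrinomial]

theorem root_real_iff {s t : ℕ} (hs : 0 < s) {p q : ℝ} (hp : p ≠ 0) (hq : q ≠ 0) (a : ℝ) :
    (a : ℂ) ∈ (trinomial s t (realTrinomial p q hp hq)).roots ↔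
      a ^ (s + t) + p * a ^ t + q = 0 := by
  rw [mem_roots_trinomial hs]
  simp only [realTrinomial, Units.val_mk0]
  norm_cast

theorem even_countP_roots_realTrinomial_iff {s t : ℕ} {p q : ℝ} (hp : p ≠ 0)
    (hq : q ≠ 0) {r : ℝ} (hr : 0 < r) (h1 : r ^ (s + t) + p * r ^ t + q ≠ 0)
    (h2 : (-r) ^ (s + t) + p * (-r) ^ t + q ≠ 0) :
    Even ((trinomial s t (realTrinomial p q hp hq)).roots.countP (‖·‖ < r)) ↔
      0 < (r ^ (s + t) + p * r ^ t + q) * ((-r) ^ (s + t) + p * (-r) ^ t + q) := by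
  let P : ℝ[X] := X ^ (s + t) + C p * X ^ t + C q
  have hP : P.map Complex.ofRealHom = trinomial s t (realTrinomial p q hp hq) := by
    simp [P, trinomial, realTrinomial]
  have hev (a : ℝ) : P.eval a = a ^ (s + t) + p * a ^ t + q := by simp [P]
  rw [← hP, even_countP_roots_iff hr P (by rwa [hev]) (by rwa [hev]), hev, hev]

/-- Distinct roots of equal norm of a real trinomial are complex conjugates. -/
theorem eq_or_eq_conj_of_roots_realTrinomial {s t : ℕ} (hs : 0 < s) (ht : 0 < t)
    (hst : Nat.Coprime s t) {p q : ℝ} (hp : p ≠ 0) (hq : q ≠ 0) {z w : ℂ}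
    (hz : z ∈ (trinomial s t (realTrinomial p q hp hq)).roots)
    (hw : w ∈ (trinomial s t (realTrinomial p q hp hq)).roots) (hzw : ‖z‖ = ‖w‖) :
    w = z ∨ w = starRingEnd ℂ z := by
  refine (eq_or_conj_of_roots_norm_eq hs ht hst hz hw hzw).imp_right fun ⟨h1, h2⟩ => ?_
  have hq' : (q : ℂ) ≠ 0 := by exact_mod_cast hq
  have hp' : (p : ℂ) ≠ 0 := by exact_mod_cast hp
  simp only [realTrinomial, Units.val_mk0, map_div₀, map_mul, map_pow, Complex.conj_ofReal] at h1 h2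
  refine eq_of_pow_eq_pow_of_coprime (m := s + t) (n := t) (by simpa using hst) ?_ ?_ ?_
  · rw [Ne, map_eq_zero]
    exact ne_zero_of_mem_roots_trinomial hs ht hz
  · exact (div_left_inj' hq').1 h1
  · exact mul_left_cancel₀ hp' ((div_left_inj' hq').1 h2)

theorem exists_gt_countP_lt_eq_countP_le (M : Multiset ℂ) (r : ℝ) :
    ∃ ρ, r < ρ ∧ (∀ z ∈ M, ‖z‖ ≠ ρ) ∧ M.countP (‖·‖ < ρ) = M.countP (‖·‖ ≤ r) := by
  have h : ∀ᶠ ρ in nhdsWithin r (Set.Ioi r), ∀ z ∈ M.toFinset, ‖z‖ ≤ r ∨ ρ < ‖z‖ := by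
    refine (Filter.eventually_all_finset _).2 fun z _ => ?_
    by_cases hz : ‖z‖ ≤ r
    · exact Filter.Eventually.of_forall fun _ => Or.inl hz
    · filter_upwards [Ioo_mem_nhdsGT (not_le.1 hz)] with ρ hρ using Or.inr hρ.2
  obtain ⟨ρ, h1, h2⟩ := (h.and self_mem_nhdsWithin).exists
  have h2 : r < ρ := h2
  refine ⟨ρ, h2, fun z hz hzρ => ?_, ?_⟩
  · rcases h1 z (Multiset.mem_toFinset.2 hz) with h | h <;> linarith
  · refine Multiset.countP_congr (p := fun z : ℂ => ‖z‖ < ρ) (p' := fun z : ℂ => ‖z‖ ≤ r) rfl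
      fun z hz => propext ⟨fun h => ?_, fun h => h.trans_lt h2⟩
    rcases h1 z (Multiset.mem_toFinset.2 hz) with h' | h'
    · exact h'
    · exact absurd h h'.not_gt

/-- A real trinomial without sign change on the positive half-line has no gap. -/
theorem not_hasGap_realTrinomial {s t : ℕ} (hs : 0 < s) (ht : 0 < t) (hst : Nat.Coprime s t)
    {c q : ℝ} (hc : 0 < c) (hq : 0 < q)
    (hpos : ∀ a : ℝ, 0 < a → 0 ≤ a ^ (s + t) - c * a ^ t + q) :
    ¬ HasGap s t (realTrinomial (-c) q (neg_ne_zero.2 hc.ne') hq.ne') := by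
  rintro ⟨r₀, hr₀⟩
  set x := realTrinomial (-c) q (neg_ne_zero.2 hc.ne') hq.ne' with hx
  obtain ⟨z, hz, hzr⟩ := Multiset.countP_pos.1 (hr₀.symm ▸ ht)
  have hr₀pos : 0 < r₀ :=
    (norm_pos_iff.2 (ne_zero_of_mem_roots_trinomial hs ht hz)).trans_le hzr
  obtain ⟨r, hr, hno, hcount⟩ := exists_gt_countP_lt_eq_countP_le (trinomial s t x).roots r₀
  rw [hr₀] at hcount
  have hrpos := hr₀pos.trans hr
  have hn1 : ‖(x.1 : ℂ)‖ = c := by simp [hx, realTrinomial, abs_of_pos hc]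
  have hn2 : ‖(x.2 : ℂ)‖ = q := by simp [hx, realTrinomial, abs_of_pos hq]
  have h1 : r ^ (s + t) + -c * r ^ t + q ≠ 0 := fun h =>
    hno r ((root_real_iff hs _ _ r).2 h) (by simp [abs_of_pos hrpos])
  have h2 : (-r) ^ (s + t) + -c * (-r) ^ t + q ≠ 0 := fun h =>
    hno (-r : ℝ) ((root_real_iff hs _ _ (-r)).2 h) (by simp [abs_of_pos hrpos])
  have h1' : 0 < r ^ (s + t) + -c * r ^ t + q := by
    refine lt_of_le_of_ne ?_ h1.symm
    have := hpos r hrpos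
    linarith
  have heven := even_countP_roots_realTrinomial_iff (neg_ne_zero.2 hc.ne') hq.ne' hrpos h1 h2
  rw [← hx, hcount, mul_pos_iff_of_pos_left h1'] at heven
  have hrn := pow_pos hrpos (s + t)
  have hrt := mul_pos hc (pow_pos hrpos t)
  rcases Nat.even_or_odd t with hte | hto
  · have hso : Odd s := by
      rw [← Nat.not_even_iff_odd]
      intro hse
      have := Nat.dvd_gcd hse.two_dvd hte.two_dvd
      rw [hst] at this
      omega
    rw [(hso.add_even hte).neg_pow, hte.neg_pow] at heven
    have h3 := heven.1 hte
    have := (countP_roots_of_constant_dominant (s := s) (t := t) (x := x) hrpos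
      (by rw [hn1, hn2]; linarith)).2
    omega
  · have h3 : ¬ 0 < (-r) ^ (s + t) + -c * (-r) ^ t + q := by
      rw [← heven, Nat.not_even_iff_odd]
      exact hto
    rcases Nat.even_or_odd s with hse | hso
    · rw [(hse.add_odd hto).neg_pow, hto.neg_pow] at h2 h3
      have h4 := lt_of_le_of_ne (not_lt.1 h3) h2
      have := (countP_roots_of_leading_dominant (s := s) (t := t) (x := x) hrpos
        (by rw [hn1, hn2]; linarith)).2
      omega
    · rw [(hso.add_odd hto).neg_pow, hto.neg_pow] at h3
      exact h3 (by linarith)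

/-- The circle through the `t`-th and `(t + 1)`-st root of a pinched real trinomial without
multiple roots contains no real root, and exactly `t - 1` roots lie inside. -/
theorem IsPinched.realTrinomial {s t : ℕ} (hs : 0 < s) (ht : 0 < t) (hst : Nat.Coprime s t)
    {p q : ℝ} (hp : p ≠ 0) (hq : q ≠ 0)
    (hnodup : (trinomial s t (realTrinomial p q hp hq)).roots.Nodup)
    (h : IsPinched s t (realTrinomial p q hp hq)) :
    ∃ r : ℝ, 0 < r ∧ (∃ z ∈ (trinomial s t (realTrinomial p q hp hq)).roots, ‖z‖ = r) ∧
      (trinomial s t (realTrinomial p q hp hq)).roots.countP (‖·‖ < r) = t - 1 ∧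
      r ^ (s + t) + p * r ^ t + q ≠ 0 ∧ (-r) ^ (s + t) + p * (-r) ^ t + q ≠ 0 := by
  obtain ⟨r, h1, h2⟩ := h
  set M := (trinomial s t (_root_.realTrinomial p q hp hq)).roots with hM
  obtain ⟨z₀, hz₀, hz₀r⟩ := Multiset.countP_pos.1 (ht.trans h2)
  have hrpos : 0 < r := (norm_pos_iff.2 (ne_zero_of_mem_roots_trinomial hs ht hz₀)).trans_le hz₀r
  set F := M.filter (‖·‖ = r) with hF
  have hsum : M.countP (‖·‖ ≤ r) = M.countP (‖·‖ < r) + F.card := by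
    rw [hF, ← Multiset.countP_eq_card_filter]
    clear_value M
    clear * -
    induction M using Multiset.induction_on with
    | empty => simp
    | cons a M ih =>
      simp only [Multiset.countP_cons, ih]
      rcases lt_trichotomy ‖a‖ r with h | h | h
      · simp [h, h.le, h.ne]; omega
      · simp [h]; omega
      · simp [h.not_ge, h.not_gt, h.ne']
  have hFcard : 2 ≤ F.card := by omega
  have hFnodup : F.Nodup := hnodup.filter _
  obtain ⟨ζ, hζ⟩ := Multiset.card_pos_iff_exists_mem.1 (by omega : 0 < F.card)
  have hζM := Multiset.mem_of_mem_filter hζ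
  have hFr {w : ℂ} (hw : w ∈ F) : ‖w‖ = r := (Multiset.mem_filter.1 hw).2
  have hζr := hFr hζ
  have hsub {w : ℂ} (hw : w ∈ F) : w = ζ ∨ w = starRingEnd ℂ ζ :=
    eq_or_eq_conj_of_roots_realTrinomial hs ht hst hp hq hζM (Multiset.mem_of_mem_filter hw)
      (hζr.trans (hFr hw).symm)
  have hle : F ≤ {ζ, starRingEnd ℂ ζ} := by
    refine (Multiset.le_iff_subset hFnodup).2 fun w hw => ?_
    simpa using hsub hw
  have hcard2 : F.card = 2 := le_antisymm (by simpa using Multiset.card_le_card hle) hFcard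
  have hnotreal : starRingEnd ℂ ζ ≠ ζ := by
    intro hreal
    have : F ≤ {ζ} := by
      refine (Multiset.le_iff_subset hFnodup).2 fun w hw => ?_
      have := hsub hw
      rw [hreal, or_self] at this
      simp [this]
    have := Multiset.card_le_card this
    simp at this
    omega
  have hnoreal (a : ℝ) (ha : |a| = r) : a ^ (s + t) + p * a ^ t + q ≠ 0 := by
    intro h0
    have hmem : (a : ℂ) ∈ F :=
      Multiset.mem_filter.2 ⟨(root_real_iff hs hp hq a).2 h0, by simpa using ha⟩
    rcases hsub hmem with h | h
    · rw [← h, Complex.conj_ofReal] at hnotreal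
      exact hnotreal rfl
    · have h' := congrArg (starRingEnd ℂ) h
      rw [Complex.conj_ofReal, Complex.conj_conj] at h'
      exact hnotreal (h.symm.trans h')
  exact ⟨r, hrpos, ⟨ζ, hζM, hζr⟩, by omega, hnoreal r (abs_of_pos hrpos),
    hnoreal (-r) (by rw [abs_neg, abs_of_pos hrpos])⟩

theorem not_isPinched_realTrinomial_of_odd {s t : ℕ} (hs : 0 < s) (ht : 0 < t)
    (hst : Nat.Coprime s t) (hodd : Odd (s + t)) {c q : ℝ} (hc : 0 < c) (hq : 0 < q)
    (hnodup : (trinomial s t (realTrinomial c q hc.ne' hq.ne')).roots.Nodup) :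
    ¬ IsPinched s t (realTrinomial c q hc.ne' hq.ne') := by
  intro h
  obtain ⟨r, hrpos, ⟨ζ, hζ, hζr⟩, hcount, h1, h2⟩ := h.realTrinomial hs ht hst _ _ hnodup
  have heven := even_countP_roots_realTrinomial_iff hc.ne' hq.ne' hrpos h1 h2
  set x := realTrinomial c q hc.ne' hq.ne' with hx
  have hrn := pow_pos hrpos (s + t)
  have hrt := mul_pos hc (pow_pos hrpos t)
  rw [hcount, mul_pos_iff_of_pos_left (by positivity), hodd.neg_pow] at heven
  rw [hodd.neg_pow] at h2
  have hn1 : ‖(x.1 : ℂ)‖ = c := by simp [hx, realTrinomial, abs_of_pos hc]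
  have hn2 : ‖(x.2 : ℂ)‖ = q := by simp [hx, realTrinomial, abs_of_pos hq]
  rcases Nat.even_or_odd t with hte | hto
  · have h3 : ¬ Even (t - 1) := by
      rw [Nat.not_even_iff_odd]
      exact Nat.Even.sub_odd ht hte odd_one
    rw [heven, hte.neg_pow, not_lt] at h3
    rw [hte.neg_pow] at h2
    have h4 := lt_of_le_of_ne h3 h2
    exact (countP_roots_of_leading_dominant (s := s) (t := t) (x := x) hrpos
        (by rw [hn1, hn2]; linarith)).1 ζ hζ hζr
  · have h3 := heven.1 (Nat.Odd.sub_odd hto odd_one)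
    rw [hto.neg_pow] at h3
    exact (countP_roots_of_constant_dominant (s := s) (t := t) (x := x) hrpos
        (by rw [hn1, hn2]; linarith)).1 ζ hζ hζr

theorem not_isPinched_realTrinomial_of_even {s t : ℕ} (hs : 0 < s) (ht : 0 < t)
    (hst : Nat.Coprime s t) (heven : Even (s + t)) {c q : ℝ} (hc : 0 < c) (hq : 0 < q)
    (hnodup : (trinomial s t (realTrinomial c (-q) hc.ne' (neg_ne_zero.2 hq.ne'))).roots.Nodup) :
    ¬ IsPinched s t (realTrinomial c (-q) hc.ne' (neg_ne_zero.2 hq.ne')) := by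
  intro h
  obtain ⟨r, hrpos, ⟨ζ, hζ, hζr⟩, hcount, h1, h2⟩ := h.realTrinomial hs ht hst _ _ hnodup
  have hto : Odd t := by
    rw [← Nat.not_even_iff_odd]
    intro hte
    have hse : Even s := (Nat.even_add.1 heven).2 hte
    have := Nat.dvd_gcd hse.two_dvd hte.two_dvd
    rw [hst] at this
    omega
  have hpar := even_countP_roots_realTrinomial_iff hc.ne' (neg_ne_zero.2 hq.ne') hrpos h1 h2
  set x := realTrinomial c (-q) hc.ne' (neg_ne_zero.2 hq.ne') with hx
  have hrn := pow_pos hrpos (s + t)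
  have hrt := mul_pos hc (pow_pos hrpos t)
  rw [hcount, heven.neg_pow, hto.neg_pow] at hpar
  have h3 := hpar.1 (Nat.Odd.sub_odd hto odd_one)
  have hn1 : ‖(x.1 : ℂ)‖ = c := by simp [hx, realTrinomial, abs_of_pos hc]
  have hn2 : ‖(x.2 : ℂ)‖ = q := by simp [hx, realTrinomial, abs_of_pos hq]
  rcases mul_pos_iff.1 h3 with ⟨-, h4⟩ | ⟨h4, -⟩
  · exact (countP_roots_of_leading_dominant (s := s) (t := t) (x := x) hrpos
        (by rw [hn1, hn2]; linarith)).1 ζ hζ hζr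
  · exact (countP_roots_of_constant_dominant (s := s) (t := t) (x := x) hrpos
        (by rw [hn1, hn2]; linarith)).1 ζ hζ hζr

/-- Weighted inequality of arithmetic and geometric means for the monomials of a trinomial. -/
theorem mul_pow_le_mul_pow_add {s t : ℕ} (ht : 0 < t) {a : ℝ} (ha : 0 < a) :
    ((s + t : ℕ) / t : ℝ) * a ^ t ≤ a ^ (s + t) + s / t := by
  have ht' : (0 : ℝ) < t := by exact_mod_cast ht
  have hn' : (0 : ℝ) < (s + t : ℕ) := by exact_mod_cast (by omega : 0 < s + t)
  have h := Real.geom_mean_le_arith_mean2_weighted (w₁ := t / (s + t : ℕ)) (w₂ := s / (s + t : ℕ))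
    (p₁ := a ^ (s + t)) (p₂ := 1) (by positivity) (by positivity) (by positivity) zero_le_one
    (by rw [← add_div, div_eq_one_iff_eq hn'.ne']; push_cast; ring)
  rw [Real.one_rpow, mul_one, mul_one, ← Real.rpow_natCast a (s + t), ← Real.rpow_mul ha.le,
    mul_div_cancel₀ _ hn'.ne', Real.rpow_natCast, Real.rpow_natCast] at h
  have := mul_le_mul_of_nonneg_left h (by positivity : (0 : ℝ) ≤ (s + t : ℕ) / t)
  refine this.trans_eq ?_
  field_simp

theorem exists_pos_pow_eq {n : ℕ} (hn : n ≠ 0) {a : ℝ} (ha : 0 < a) : ∃ c : ℝ, 0 < c ∧ c ^ n = a :=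
  ⟨a ^ (n⁻¹ : ℝ), Real.rpow_pos_of_pos ha _, Real.rpow_inv_natCast_pow ha.le hn⟩

theorem discriminantValue_ne_zero {s t : ℕ} (hs : 0 < s) (ht : 0 < t) :
    discriminantValue s t ≠ 0 := by
  have : s + t ≠ 0 := by omega
  unfold discriminantValue
  simp only [ne_eq, div_eq_zero_iff, mul_eq_zero, pow_eq_zero_iff', neg_eq_zero, one_ne_zero,
    Nat.cast_eq_zero]
  tauto

/-- A trinomial whose invariant is a positive multiple of the critical value, in normal form. -/
theorem exists_normalForm {s t : ℕ} (hs : 0 < s) (ht : 0 < t) {τ : ℝ} (hτ : 0 < τ) :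
    ∃ c : ℝ, ∃ hc : 0 < c, ∃ hq : (0 : ℝ) < s / t,
      c ^ (s + t) = τ * ((s + t : ℕ) / t : ℝ) ^ (s + t) ∧
      trinomialInvariant s t (realTrinomial (-c) (s / t) (neg_ne_zero.2 hc.ne') hq.ne') =
        τ * discriminantValue s t := by
  have hs' : (0 : ℝ) < s := by exact_mod_cast hs
  have ht' : (0 : ℝ) < t := by exact_mod_cast ht
  have hn' : (0 : ℝ) < (s + t : ℕ) := by exact_mod_cast (by omega : 0 < s + t)
  obtain ⟨c, hc, hcn⟩ := exists_pos_pow_eq (n := s + t) (by omega)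
    (a := τ * ((s + t : ℕ) / t : ℝ) ^ (s + t)) (by positivity)
  refine ⟨c, hc, by positivity, hcn, ?_⟩
  rw [trinomialInvariant_realTrinomial, ← Complex.ofReal_mul, neg_pow, hcn, discriminantValue,
    div_pow, div_pow]
  congr 1
  field_simp
  ring

theorem not_hasGap_of_invariant {s t : ℕ} (hs : 0 < s) (ht : 0 < t) (hst : Nat.Coprime s t)
    {x : TrinomialSpace} {τ : ℝ} (hτ : 0 < τ) (hτ1 : τ ≤ 1)
    (h : trinomialInvariant s t x = τ * discriminantValue s t) : ¬ HasGap s t x := by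
  obtain ⟨c, hc, hq, hcn, hinv⟩ := exists_normalForm hs ht hτ
  intro hgap
  refine not_hasGap_realTrinomial hs ht hst hc hq (fun a ha => ?_)
    (hgap.of_invariant_eq hs ht hst (h.trans hinv.symm))
  have hle : c ≤ ((s + t : ℕ) / t : ℝ) := by
    refine le_of_pow_le_pow_left₀ (n := s + t) (by omega) (by positivity) ?_
    rw [hcn]
    exact mul_le_of_le_one_left (by positivity) hτ1
  have := mul_pow_le_mul_pow_add (s := s) ht ha
  have := mul_le_mul_of_nonneg_right hle (pow_pos ha t).le
  linarith

theorem hasGap_of_invariant_gt {s t : ℕ} (hs : 0 < s) (ht : 0 < t) (hst : Nat.Coprime s t)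
    {x : TrinomialSpace} {τ : ℝ} (hτ : 1 < τ)
    (h : trinomialInvariant s t x = τ * discriminantValue s t) : HasGap s t x := by
  obtain ⟨c, hc, hq, hcn, hinv⟩ := exists_normalForm hs ht (one_pos.trans hτ)
  refine HasGap.of_invariant_eq hs ht hst (hinv.trans h.symm) ⟨1, ?_⟩
  set y := realTrinomial (-c) (s / t) (neg_ne_zero.2 hc.ne') hq.ne' with hy
  have hn1 : ‖(y.1 : ℂ)‖ = c := by simp [hy, realTrinomial, abs_of_pos hc]
  have hn2 : ‖(y.2 : ℂ)‖ = s / t := by simp [hy, realTrinomial]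
  have ht' : (0 : ℝ) < t := by exact_mod_cast ht
  have hn' : (0 : ℝ) < (s + t : ℕ) := by exact_mod_cast (by omega : 0 < s + t)
  have hlt : ((s + t : ℕ) / t : ℝ) < c := by
    refine lt_of_pow_lt_pow_left₀ (s + t) hc.le ?_
    rw [hcn]
    exact lt_mul_of_one_lt_left (by positivity) hτ
  have hsum : ((s + t : ℕ) / t : ℝ) = 1 + s / t := by
    push_cast
    field_simp
    ring
  obtain ⟨h1, h2⟩ := countP_roots_of_middle_dominant (s := s) (t := t) (x := y) one_pos
    (by rw [hn1, hn2, one_pow, one_pow, ← hsum, mul_one]; exact hlt)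
  refine Eq.trans ?_ h2
  exact Multiset.countP_congr (p := fun z : ℂ => ‖z‖ ≤ 1) (p' := fun z : ℂ => ‖z‖ < 1) rfl
    fun z hz => propext ⟨fun h => lt_of_le_of_ne h (h1 z hz), le_of_lt⟩

theorem nodup_roots_of_invariant_ne {s t : ℕ} (hs : 0 < s) (ht : 0 < t) (hst : Nat.Coprime s t)
    {x : TrinomialSpace} (h : trinomialInvariant s t x ≠ discriminantValue s t) :
    (trinomial s t x).roots.Nodup := by
  rw [Ne, ← discr_trinomial_eq_zero_iff_invariant hs ht hst, discr_trinomial_eq_zero_iff hs ht,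
    not_not] at h
  exact nodup_roots h

theorem hasGap_of_invariant_neg {s t : ℕ} (hs : 0 < s) (ht : 0 < t) (hst : Nat.Coprime s t)
    {x : TrinomialSpace} {τ : ℝ} (hτ : τ < 0)
    (h : trinomialInvariant s t x = τ * discriminantValue s t) : HasGap s t x := by
  have hn' : (0 : ℝ) < (s + t : ℕ) := by exact_mod_cast (by omega : 0 < s + t)
  have hs' : (0 : ℝ) < s := by exact_mod_cast hs
  have ht' : (0 : ℝ) < t := by exact_mod_cast ht
  have hne (y : TrinomialSpace) (hy : trinomialInvariant s t y = τ * discriminantValue s t) :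
      trinomialInvariant s t y ≠ discriminantValue s t := by
    rw [hy, ← Complex.ofReal_mul, Ne, Complex.ofReal_inj, mul_eq_right₀
      (discriminantValue_ne_zero hs ht)]
    linarith
  obtain ⟨c, hc, hcn⟩ := exists_pos_pow_eq (n := s + t) (by omega)
    (a := -τ * ((s + t : ℕ) ^ (s + t) / (t ^ t * s ^ s)))
    (mul_pos (neg_pos.2 hτ) (by positivity))
  rcases Nat.even_or_odd (s + t) with heven | hodd
  · have hso : Odd s := by
      rw [← Nat.not_even_iff_odd]
      intro hse
      have hte : Even t := (Nat.even_add.1 heven).1 hse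
      have := Nat.dvd_gcd hse.two_dvd hte.two_dvd
      rw [hst] at this
      omega
    have hy : trinomialInvariant s t
        (realTrinomial c (-1) hc.ne' (neg_ne_zero.2 one_pos.ne')) = τ * discriminantValue s t := by
      rw [trinomialInvariant_realTrinomial, ← Complex.ofReal_mul, hcn, discriminantValue,
        heven.neg_one_pow, hso.neg_one_pow]
      congr 1
      ring
    refine HasGap.of_invariant_eq hs ht hst (hy.trans h.symm) ?_
    by_contra hgap
    exact not_isPinched_realTrinomial_of_even hs ht hst heven hc one_pos
      (nodup_roots_of_invariant_ne hs ht hst (hne _ hy)) ((isPinched_iff_not_hasGap hs ht _).2 hgap)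
  · have hy : trinomialInvariant s t
        (realTrinomial c 1 hc.ne' one_pos.ne') = τ * discriminantValue s t := by
      rw [trinomialInvariant_realTrinomial, ← Complex.ofReal_mul, hcn, discriminantValue,
        hodd.neg_one_pow, one_pow]
      congr 1
      ring
    refine HasGap.of_invariant_eq hs ht hst (hy.trans h.symm) ?_
    by_contra hgap
    exact not_isPinched_realTrinomial_of_odd hs ht hst hodd hc one_pos
      (nodup_roots_of_invariant_ne hs ht hst (hne _ hy)) ((isPinched_iff_not_hasGap hs ht _).2 hgap)

theorem IsPinched.conj_invariant {s t : ℕ} (hs : 0 < s) (ht : 0 < t) (hst : Nat.Coprime s t)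
    {x : TrinomialSpace} (hnodup : (trinomial s t x).roots.Nodup) (h : IsPinched s t x) :
    starRingEnd ℂ (trinomialInvariant s t x) = trinomialInvariant s t x := by
  obtain ⟨r, h1, h2⟩ := h
  by_contra hne
  have hinj {z w : ℂ} (hz : z ∈ (trinomial s t x).roots) (hw : w ∈ (trinomial s t x).roots)
      (hzw : ‖z‖ = ‖w‖) : w = z := by
    by_contra h
    exact hne (conj_invariant_of_roots_norm_eq hs ht hst hz hw hzw h)
  rw [Multiset.countP_eq_card_filter] at h1 h2
  set A := (trinomial s t x).roots.filter (‖·‖ < r) with hA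
  set B := (trinomial s t x).roots.filter (‖·‖ ≤ r) with hB
  have hAB : A ≤ B := Multiset.monotone_filter_right _ fun _ h => le_of_lt h
  obtain ⟨D, hD⟩ := Multiset.le_iff_exists_add.1 hAB
  have hcard : 2 ≤ D.card := by
    rw [hD, Multiset.card_add] at h2
    omega
  have hBnodup : B.Nodup := hnodup.filter _
  rw [hD] at hBnodup
  have hDr {z : ℂ} (hz : z ∈ D) : z ∈ (trinomial s t x).roots ∧ ‖z‖ = r := by
    have hzB : z ∈ B := hD ▸ Multiset.mem_add.2 (Or.inr hz)
    have hzr := Multiset.mem_of_mem_filter hzB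
    refine ⟨hzr, le_antisymm (Multiset.mem_filter.1 hzB).2 (not_lt.1 fun hlt => ?_)⟩
    exact Multiset.disjoint_left.1 (Multiset.nodup_add.1 hBnodup).2.2
      (Multiset.mem_filter.2 ⟨hzr, hlt⟩) hz
  obtain ⟨z, hz⟩ := Multiset.card_pos_iff_exists_mem.1 (by omega : 0 < D.card)
  have hle : D ≤ {z} := by
    refine (Multiset.le_iff_subset (Multiset.nodup_add.1 hBnodup).2.1).2 fun w hw => ?_
    rw [Multiset.mem_singleton]
    exact hinj (hDr hz).1 (hDr hw).1 ((hDr hz).2.trans (hDr hw).2.symm)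
  have := Multiset.card_le_card hle
  simp at this
  omega

theorem not_hasGap_iff {s t : ℕ} (hs : 0 < s) (ht : 0 < t) (hst : Nat.Coprime s t)
    (x : TrinomialSpace) : ¬ HasGap s t x ↔
      ∃ τ : ℝ, 0 < τ ∧ τ ≤ 1 ∧ trinomialInvariant s t x = τ * discriminantValue s t := by
  refine ⟨fun h => ?_, fun ⟨τ, h0, h1, h⟩ => not_hasGap_of_invariant hs ht hst h0 h1 h⟩
  by_cases hdisc : trinomialInvariant s t x = discriminantValue s t
  · exact ⟨1, one_pos, le_rfl, by simpa using hdisc⟩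
  have hp := (isPinched_iff_not_hasGap hs ht x).2 h
  obtain ⟨a, ha⟩ := Complex.conj_eq_iff_real.1
    (hp.conj_invariant hs ht hst (nodup_roots_of_invariant_ne hs ht hst hdisc))
  have hd := discriminantValue_ne_zero hs ht
  have hτ : trinomialInvariant s t x = ((a / discriminantValue s t : ℝ) : ℂ) *
      discriminantValue s t := by
    rw [ha, ← Complex.ofReal_mul, div_mul_cancel₀ _ hd]
  set τ := a / discriminantValue s t
  have hτ0 : τ ≠ 0 := by
    intro h0
    rw [h0, Complex.ofReal_zero, zero_mul, trinomialInvariant, div_eq_zero_iff] at hτ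
    rcases hτ with h | h
    exacts [pow_ne_zero _ x.1.ne_zero h, pow_ne_zero _ x.2.ne_zero h]
  refine ⟨τ, lt_of_not_ge fun h0 => ?_, le_of_not_gt fun h1 => ?_, hτ⟩
  · exact h (hasGap_of_invariant_neg hs ht hst (lt_of_le_of_ne h0 hτ0) hτ)
  · exact h (hasGap_of_invariant_gt hs ht hst h1 hτ)

end Polynomials

theorem mainTheorem2 (s t : ℕ) (hs : 0 < s) (ht : 0 < t) (hst : Nat.Coprime s t) :
    IsDeformationRetract (discriminantLocus s t) (distinctNormSet s t t)ᶜ ∧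
    (∃ K : Set TrinomialSpace, IsDeformationRetract K (discriminantLocus s t) ∧
      IsTorusKnot (s + t) s K) ∧
    IsConnected (discriminantLocus s t) ∧
    ¬ IsSimplyConnected (discriminantLocus s t) ∧
    (∀ x : discriminantLocus s t,
      Nonempty (FundamentalGroup (discriminantLocus s t) x ≃* Multiplicative ℤ)) ∧
    IsConnected (distinctNormSet s t t) ∧
    (∀ x : distinctNormSet s t t,
      Nonempty (FundamentalGroup (distinctNormSet s t t) x ≃* Multiplicative (ℤ × ℤ))) := by
  obtain ⟨a, b, hab⟩ : ∃ a b : ℤ, a * (s : ℤ) + b * ((s + t : ℕ) : ℤ) = 1 := by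
    obtain ⟨a, b, hab⟩ := Nat.isCoprime_iff_coprime.2 hst
    exact ⟨a - b, b, by push_cast; linarith⟩
  let w₀ : ℂˣ := Units.mk0 (discriminantValue s t : ℂ)
    (by exact_mod_cast discriminantValue_ne_zero hs ht)
  refine topology_of_monomialCoordinates s (s + t) a b hab w₀ _ _ ?_ ?_
  · ext x
    simp only [discriminantLocus, Set.mem_ofPred_eq, Set.mem_preimage, Set.mem_prod, Set.mem_univ,
      and_true, Set.mem_singleton_iff]
    rw [discr_trinomial_eq_zero_iff_invariant hs ht hst, Units.ext_iff,
      trinomialInvariant_eq_monomialCoordinates, Units.val_mk0]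
  · ext x
    rw [Set.mem_compl_iff, mem_distinctNormSet_iff_hasGap hs ht, not_hasGap_iff hs ht hst]
    simp only [unitSegment, Set.mem_preimage, Set.mem_prod, Set.mem_univ, and_true,
      Set.mem_ofPred_eq, trinomialInvariant_eq_monomialCoordinates, w₀, Units.val_mk0]
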